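/- Let $d\ge 3$ and let $V(x)=|x|^2$ on $\mathbb{R}^d$. Let $L_V=-\Delta+V$ be the non-negative self-adjoint operator on $L^2(\mathbb{R}^d)$ associated with the form $\int\nabla u\cdot\nabla v+\int Vuv$ on its maximal domain, let $k_t(x,y)$ be the continuous integral kernel of $e^{-tL_V}$, $t>0$, and for $f\in L^1_{loc}(\mathbb{R}^d)$ put $$T^*_{|x|^2}f(x)=\sup_{t>0}e^{-tL_V}|f|(x)=\sup_{t>0}\int_{\mathbb{R}^d}k_t(x,y)|f(y)|\,dy\in[0,\infty].$$ A weight is a locally integrable function $w$ on $\mathbb{R}^d$ with $w>0$ almost everywhere, and $L^p(w)=L^p(\mathbb{R}^d;w\,dx)$. Let $$\rho_V(x)=\sup\Big\{r>0:\frac1{r^{d-2}}\int_{B(x,r)}V(y)\,dy\le 1\Big\},\qquad \Phi^V_{m,c}(x,r)=\exp\Big(c\Big(1+\frac r{\rho_V(x)}\Big)^m\Big).$$ For $1<p<\infty$ and $c,m>0$ let $H^{V,m}_{p,c}$ be the class of all weights $w$ with $$\sup_{B}\Big(\frac1{|B|\,\Phi^V_{m,c}(x,r)}\int_B w\Big)^{\frac1p}\Big(\frac1{|B|\,\Phi^V_{m,c}(x,r)}\int_B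 w^{-\frac1{p-1}}\Big)^{\frac{p-1}p}<\infty,$$ where the supremum is over all Euclidean balls $B=B(x,r)$, $x\in\mathbb{R}^d$, $r>0$. Then there exist constants $c,m>0$, depending only on $d$, such that for every $1<p<\infty$ and every weight $w$: if $T^*_{|x|^2}$ is bounded on $L^p(w)$, that is, if there is $C<\infty$ with $\|T^*_{|x|^2}f\|_{L^p(w)}\le C\|f\|_{L^p(w)}$ for all $f\in L^p(w)\cap L^1_{loc}(\mathbb{R}^d)$, then $w\in H^{V,m}_{p,c}$. -/

import Mathlib

open MeasureTheory Set Metric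
open scoped ENNReal NNReal ContDiff

noncomputable section

/-- Euclidean space of dimension `d`. -/
abbrev Eucl (d : ℕ) : Type := EuclideanSpace ℝ (Fin d)

/-- Real Hilbert space of (classes of) square integrable functions for Lebesgue measure. -/
abbrev L2 (d : ℕ) : Type := Lp ℝ 2 (volume : Measure (Eucl d))

/-- `G` is the gradient of `u` in the sense of distributions. -/
def HasWeakGradient {d : ℕ} (u : Eucl d → ℝ) (G : Eucl d → Eucl d) : Prop :=
  ∀ φ : Eucl d → ℝ, ContDiff ℝ ∞ φ → HasCompactSupport φ → ∀ e : Eucl d,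
    ∫ x, u x * fderiv ℝ φ x e = - ∫ x, φ x * inner ℝ (G x) e

/-- `u` lies in the maximal form domain of `-Δ + V`, and `G` is its weak gradient:
`u`, `∇u` and `V^{1/2} u` are square integrable. -/
structure InFormDomain {d : ℕ} (V : Eucl d → ℝ) (u : Eucl d → ℝ) (G : Eucl d → Eucl d) :
    Prop where
  memLp : MemLp u 2 volume
  memLp_grad : MemLp G 2 volume
  weakGradient : HasWeakGradient u G
  integrable_potential : Integrable (fun x => V x * u x ^ 2) volume

/-- The graph of the Schrödinger operator `L_V = -Δ + V` on `L²`, the operator associated with the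
form `Q(u, v) = ∫ ⟨∇u, ∇v⟩ + ∫ V u v` on its maximal domain: `SchrodingerOp V u g` says that `u` is
in the domain of `L_V` and `L_V u = g`. -/
def SchrodingerOp {d : ℕ} (V : Eucl d → ℝ) (u g : L2 d) : Prop :=
  ∃ G : Eucl d → Eucl d, InFormDomain V u G ∧
    ∀ (v : Eucl d → ℝ) (H : Eucl d → Eucl d), InFormDomain V v H →
      (∫ x, inner ℝ (G x) (H x)) + ∫ x, V x * u x * v x = ∫ x, g x * v x

/-- `t ↦ u t` is the orbit `t ↦ e^{-t L_V} f` of the heat semigroup on `L²`: the solution, continuous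
on `[0, ∞)` and differentiable on `(0, ∞)`, of `u' = -L_V u`, `u 0 = f`. -/
structure IsHeatFlow {d : ℕ} (V : Eucl d → ℝ) (f : L2 d) (u : ℝ → L2 d) : Prop where
  initial : u 0 = f
  continuousOn : ContinuousOn u (Ici 0)
  evolution : ∀ t : ℝ, 0 < t → ∃ g : L2 d, SchrodingerOp V (u t) g ∧ HasDerivAt u (-g) t

/-- `k t x y` (for `t > 0`) is the continuous integral kernel of the heat semigroup
`e^{-t L_V}` on `L²`. -/
structure IsHeatKernel {d : ℕ} (V : Eucl d → ℝ) (k : ℝ → Eucl d → Eucl d → ℝ) : Prop where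
  continuousOn : ContinuousOn (fun q : ℝ × Eucl d × Eucl d => k q.1 q.2.1 q.2.2)
    (Ioi 0 ×ˢ univ)
  represents : ∀ f : L2 d, ∃ u : ℝ → L2 d, IsHeatFlow V f u ∧ ∀ t : ℝ, 0 < t →
    ∀ᵐ x : Eucl d, Integrable (fun y => k t x y * f y) volume ∧ u t x = ∫ y, k t x y * f y

open Classical in
/-- The heat kernel of `L_V`, that is, the continuous kernel of `e^{-t L_V}` (and zero if there is
none). -/
def heatKernel {d : ℕ} (V : Eucl d → ℝ) : ℝ → Eucl d → Eucl d → ℝ :=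
  if h : ∃ k, IsHeatKernel V k then h.choose else 0

/-- The heat maximal operator `T*_V f(x) = sup_{t > 0} e^{-t L_V} |f| (x)`, with values in
`[0, ∞]`. -/
def heatMaximal {d : ℕ} (V : Eucl d → ℝ) (f : Eucl d → ℝ) (x : Eucl d) : ℝ≥0∞ :=
  ⨆ (t : ℝ) (_ : 0 < t), ∫⁻ y, ENNReal.ofReal (heatKernel V t x y) * ‖f y‖ₑ

/-- A weight: a locally integrable function that is positive almost everywhere. -/
structure IsWeight {d : ℕ} (w : Eucl d → ℝ) : Prop where
  locallyIntegrable : LocallyIntegrable w volume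
  ae_pos : ∀ᵐ x, 0 < w x

/-- The measure `w dx`, so that `L^p(w) = L^p(w dx)`. -/
def weightMeasure {d : ℕ} (w : Eucl d → ℝ) : Measure (Eucl d) :=
  volume.withDensity fun x => ENNReal.ofReal (w x)

/-- `T*_V` is bounded on `L^p(w)`. -/
def HeatMaximalBounded {d : ℕ} (V : Eucl d → ℝ) (p : ℝ) (w : Eucl d → ℝ) : Prop :=
  ∃ C : ℝ≥0, ∀ f : Eucl d → ℝ, LocallyIntegrable f volume →
    MemLp f (ENNReal.ofReal p) (weightMeasure w) →
      eLpNorm (heatMaximal V f) (ENNReal.ofReal p) (weightMeasure w)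
        ≤ C * eLpNorm f (ENNReal.ofReal p) (weightMeasure w)

/-- The critical radius function
`ρ_V(x) = sup {r > 0 : r^{-(d-2)} ∫_{B(x,r)} V ≤ 1}`. -/
def criticalRadius {d : ℕ} (V : Eucl d → ℝ) (x : Eucl d) : ℝ :=
  sSup {r : ℝ | 0 < r ∧ 1 / r ^ ((d : ℤ) - 2) * ∫ y in ball x r, V y ≤ 1}

/-- `Φ^V_{m,c}(x,r) = exp (c (1 + r / ρ_V(x))^m)`. -/
def growthFactor {d : ℕ} (V : Eucl d → ℝ) (m c : ℝ) (x : Eucl d) (r : ℝ) : ℝ :=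
  Real.exp (c * (1 + r / criticalRadius V x) ^ m)

/-- The characteristic `[w]_{H^{V,m}_{p,c}}`, a supremum over all Euclidean balls. -/
def heatWeightConst {d : ℕ} (V : Eucl d → ℝ) (m p c : ℝ) (w : Eucl d → ℝ) : ℝ≥0∞ :=
  ⨆ (x : Eucl d) (r : ℝ) (_ : 0 < r),
    ((∫⁻ y in ball x r, ENNReal.ofReal (w y)) /
        (volume (ball x r) * ENNReal.ofReal (growthFactor V m c x r))) ^ (1 / p) *
    ((∫⁻ y in ball x r, ENNReal.ofReal (w y) ^ (-(1 / (p - 1)))) /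
        (volume (ball x r) * ENNReal.ofReal (growthFactor V m c x r))) ^ ((p - 1) / p)

/-- The class `H^{V,m}_{p,c}` of weights. -/
def HeatWeightClass {d : ℕ} (V : Eucl d → ℝ) (m p c : ℝ) : Set (Eucl d → ℝ) :=
  {w | IsWeight w ∧ heatWeightConst V m p c w < (⊤ : ℝ≥0∞)}

/-- The harmonic oscillator potential `V(x) = |x|²`. -/
def harmonicPotential (d : ℕ) (x : Eucl d) : ℝ := ‖x‖ ^ 2

end

open scoped Topology

/-! Only a lower bound for the heat kernel is needed. Suppose `k_t(x,y) ≥ κ` on `B × B` for one time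
`t`. Testing the maximal inequality on the dual weight `w^{-1/(p-1)}` restricted to `B` gives `κ
(∫_B w)^{1/p} (∫_B w^{-1/(p-1)})^{(p-1)/p} ≤ C` (`mul_rpow_dual_le_of_heatMaximal_le`). The dual
weight need not be integrable on `B`, so it is first truncated.

For `V = |x|²` the kernel is given by Mehler's formula. On `B = B(x₀,r)` at time `min 1 r²` it is at
least a constant times `r^{-d} exp(-3E²)`, where `E = 1 + r(1+|x₀|)` (`le_mehler_of_mem_ball`).
Since the critical radius is at most a multiple of `1/(1+|x₀|)` (`exists_le_div_criticalRadius`),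
`E` is bounded by a multiple of `1 + r/ρ(x₀)`. The exponential loss is therefore absorbed by the
growth factor with `m = 2`, and `r^{-d}` by the volume of `B`.

The longer task is to identify `heatKernel`, which is specified only through the form and the
evolution equation, with Mehler's kernel. Uniqueness comes from monotonicity of the operator: the
distance between two flows cannot increase, and continuity then determines the kernel pointwise.
Existence (`isHeatKernel_mehler`) rests on Gaussian bounds for the kernel and its derivatives. They
justify Fubini and differentiation under the integral, so the heat equation need only be checked in
`x` for each fixed `y`. -/

/-! ### Uniqueness of the heat flow and of its continuous kernel -/

theorem MemLp.integrable_inner_of_two {d : ℕ} {G H : Eucl d → Eucl d} (hG : MemLp G 2 volume)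
    (hH : MemLp H 2 volume) : Integrable (fun x => (inner ℝ (G x) (H x) : ℝ)) volume := by
  refine Integrable.mono' (hG.norm.integrable_mul hH.norm)
    (hG.1.inner hH.1) (Filter.Eventually.of_forall fun x => ?_)
  simpa using abs_real_inner_le_norm (G x) (H x)

theorem InFormDomain.integrable_mul {d : ℕ} {V : Eucl d → ℝ} (hV : ∀ x, 0 ≤ V x)
    (hVm : Measurable V) {u v : Eucl d → ℝ} {G H : Eucl d → Eucl d} (hu : InFormDomain V u G)
    (hv : InFormDomain V v H) : Integrable (fun x => V x * u x * v x) volume := by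
  refine Integrable.mono' (hu.integrable_potential.add hv.integrable_potential)
    ((hVm.aestronglyMeasurable.mul hu.memLp.1).mul hv.memLp.1)
    (Filter.Eventually.of_forall fun x => ?_)
  simp only [Pi.add_apply, Real.norm_eq_abs]
  rw [← mul_add, mul_assoc, abs_mul, abs_of_nonneg (hV x)]
  refine mul_le_mul_of_nonneg_left ?_ (hV x)
  rw [abs_le]
  constructor <;> nlinarith [sq_nonneg (u x - v x), sq_nonneg (u x + v x)]

theorem L2.inner_eq_integral_mul {d : ℕ} (f g : L2 d) :
    (inner ℝ f g : ℝ) = ∫ x, g x * f x := by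
  rw [L2.inner_def]
  rfl

theorem integral_sub_sub_sub {α : Type*} [MeasurableSpace α] {μ : Measure α} {a b c e : α → ℝ}
    (ha : Integrable a μ) (hb : Integrable b μ) (hc : Integrable c μ) (he : Integrable e μ) :
    ∫ x, ((a x - b x) - (c x - e x)) ∂μ
      = ((∫ x, a x ∂μ) - ∫ x, b x ∂μ) - ((∫ x, c x ∂μ) - ∫ x, e x ∂μ) := by
  have h₁ : Integrable (fun x => a x - b x) μ := ha.sub hb
  have h₂ : Integrable (fun x => c x - e x) μ := hc.sub he
  rw [integral_sub h₁ h₂, integral_sub ha hb, integral_sub hc he]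

/-- The operator `L_V` is monotone. -/
theorem SchrodingerOp.inner_sub_nonneg {d : ℕ} {V : Eucl d → ℝ} (hV : ∀ x, 0 ≤ V x)
    (hVm : Measurable V) {u₁ u₂ g₁ g₂ : L2 d} (h₁ : SchrodingerOp V u₁ g₁)
    (h₂ : SchrodingerOp V u₂ g₂) : 0 ≤ (inner ℝ (u₁ - u₂) (g₁ - g₂) : ℝ) := by
  obtain ⟨G₁, d₁, h₁⟩ := h₁
  obtain ⟨G₂, d₂, h₂⟩ := h₂
  rw [inner_sub_left, inner_sub_right, inner_sub_right]
  simp only [L2.inner_eq_integral_mul]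
  -- Each weak equation is tested against both solutions. The four form values recombine into `∫ |G₁
  -- - G₂|² + ∫ V (u₁ - u₂)²`, so the difference itself never has to be placed in the form domain.
  rw [← h₁ _ _ d₁, ← h₁ _ _ d₂, ← h₂ _ _ d₁, ← h₂ _ _ d₂]
  have hI₁₁ := MemLp.integrable_inner_of_two d₁.memLp_grad d₁.memLp_grad
  have hI₁₂ := MemLp.integrable_inner_of_two d₁.memLp_grad d₂.memLp_grad
  have hI₂₁ := MemLp.integrable_inner_of_two d₂.memLp_grad d₁.memLp_grad
  have hI₂₂ := MemLp.integrable_inner_of_two d₂.memLp_grad d₂.memLp_grad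
  have hJ₁₁ := d₁.integrable_mul hV hVm d₁
  have hJ₁₂ := d₁.integrable_mul hV hVm d₂
  have hJ₂₁ := d₂.integrable_mul hV hVm d₁
  have hJ₂₂ := d₂.integrable_mul hV hVm d₂
  have hI : 0 ≤ ∫ x, ((inner ℝ (G₁ x) (G₁ x) - inner ℝ (G₂ x) (G₁ x))
      - (inner ℝ (G₁ x) (G₂ x) - inner ℝ (G₂ x) (G₂ x)) : ℝ) := by
    refine integral_nonneg fun x => ?_
    have := real_inner_self_nonneg (x := G₁ x - G₂ x)
    rw [inner_sub_left, inner_sub_right, inner_sub_right] at this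
    simp only [Pi.zero_apply]
    linarith
  have hJ : 0 ≤ ∫ x, ((V x * u₁ x * u₁ x - V x * u₂ x * u₁ x)
      - (V x * u₁ x * u₂ x - V x * u₂ x * u₂ x) : ℝ) := by
    refine integral_nonneg fun x => ?_
    have := mul_nonneg (hV x) (sq_nonneg (u₁ x - u₂ x))
    simp only [Pi.zero_apply]
    nlinarith
  rw [integral_sub_sub_sub hI₁₁ hI₂₁ hI₁₂ hI₂₂] at hI
  rw [integral_sub_sub_sub hJ₁₁ hJ₂₁ hJ₁₂ hJ₂₂] at hJ
  linarith

/-- The heat flow is unique. -/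
theorem IsHeatFlow.eq_of_isHeatFlow {d : ℕ} {V : Eucl d → ℝ} (hV : ∀ x, 0 ≤ V x)
    (hVm : Measurable V) {f : L2 d} {u₁ u₂ : ℝ → L2 d} (h₁ : IsHeatFlow V f u₁)
    (h₂ : IsHeatFlow V f u₂) {t : ℝ} (ht : 0 ≤ t) : u₁ t = u₂ t := by
  -- The squared distance of the two flows vanishes at time `0` and has derivative `-2⟨u₁ - u₂, g₁ -
  -- g₂⟩ ≤ 0` at positive times.
  have hanti : AntitoneOn (fun s => (inner ℝ (u₁ s - u₂ s) (u₁ s - u₂ s) : ℝ)) (Ici 0) := by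
    have hder : ∀ s : ℝ, 0 < s → ∃ e : ℝ, e ≤ 0 ∧
        HasDerivAt (fun s => (inner ℝ (u₁ s - u₂ s) (u₁ s - u₂ s) : ℝ)) e s := by
      intro s hs
      obtain ⟨g₁, hg₁, hd₁⟩ := h₁.evolution s hs
      obtain ⟨g₂, hg₂, hd₂⟩ := h₂.evolution s hs
      have hd := hd₁.sub hd₂
      refine ⟨_, ?_, hd.inner ℝ hd⟩
      have := SchrodingerOp.inner_sub_nonneg hV hVm hg₁ hg₂
      have e : -g₁ - -g₂ = -(g₁ - g₂) := by abel
      simp only [Pi.sub_apply]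
      rw [e, inner_neg_left, inner_neg_right, real_inner_comm]
      rw [real_inner_comm] at this
      linarith
    refine antitoneOn_of_deriv_nonpos (convex_Ici 0) ?_ ?_ ?_
    · exact (h₁.continuousOn.sub h₂.continuousOn).inner (h₁.continuousOn.sub h₂.continuousOn)
    · intro s hs
      rw [interior_Ici] at hs
      obtain ⟨e, -, he⟩ := hder s hs
      exact he.differentiableAt.differentiableWithinAt
    · intro s hs
      rw [interior_Ici] at hs
      obtain ⟨e, he0, he⟩ := hder s hs
      rw [he.deriv]
      exact he0
  have h := hanti (self_mem_Ici) (mem_Ici.2 ht) ht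
  simp only [h₁.initial, h₂.initial, sub_self, inner_zero_left] at h
  have h0 : (inner ℝ (u₁ t - u₂ t) (u₁ t - u₂ t) : ℝ) = 0 := le_antisymm h real_inner_self_nonneg
  exact sub_eq_zero.1 (inner_self_eq_zero.1 h0)

/-- Any two continuous heat kernels agree; one inequality suffices by symmetry. -/
theorem IsHeatKernel.le_of_isHeatKernel {d : ℕ} {V : Eucl d → ℝ} (hV : ∀ x, 0 ≤ V x)
    (hVm : Measurable V) {k₁ k₂ : ℝ → Eucl d → Eucl d → ℝ} (h₁ : IsHeatKernel V k₁)
    (h₂ : IsHeatKernel V k₂) {t : ℝ} (ht : 0 < t) (x y : Eucl d) : k₁ t x y ≤ k₂ t x y := by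
  by_contra! hlt
  have hcont : ∀ k : ℝ → Eucl d → Eucl d → ℝ, IsHeatKernel V k →
      Continuous fun q : Eucl d × Eucl d => k t q.1 q.2 := by
    intro k hk
    refine hk.continuousOn.comp_continuous
      (f := fun q : Eucl d × Eucl d => (t, q.1, q.2)) (by fun_prop) fun q => ⟨ht, mem_univ _⟩
  have hopen : IsOpen {q : Eucl d × Eucl d | k₂ t q.1 q.2 < k₁ t q.1 q.2} :=
    isOpen_lt (hcont _ h₂) (hcont _ h₁)
  obtain ⟨ε, hε, hball⟩ := Metric.isOpen_iff.1 hopen (x, y) hlt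
  have hmem : ∀ a ∈ ball x ε, ∀ b ∈ ball y ε, k₂ t a b < k₁ t a b := by
    intro a ha b hb
    exact hball (show (a, b) ∈ ball (x, y) ε by
      rw [← ball_prod_same]; exact ⟨ha, hb⟩)
  have hfin : volume (ball y ε) ≠ ⊤ := measure_ball_lt_top.ne
  -- Both kernels applied to the indicator of `ball y ε` give the same function almost everywhere,
  -- yet the strict inequality separates the two integrals at every point of `ball x ε`. That ball
  -- would then be null.
  set f : L2 d := indicatorConstLp 2 (measurableSet_ball (x := y) (ε := ε)) hfin (1 : ℝ) with hf
  have hfae : (f : Eucl d → ℝ) =ᵐ[volume] (ball y ε).indicator fun _ => 1 :=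
    indicatorConstLp_coeFn
  obtain ⟨u₁, hu₁, hr₁⟩ := h₁.represents f
  obtain ⟨u₂, hu₂, hr₂⟩ := h₂.represents f
  have hu : u₁ t = u₂ t := hu₁.eq_of_isHeatFlow hV hVm hu₂ ht.le
  have key : ∀ᵐ a : Eucl d, a ∉ ball x ε := by
    filter_upwards [hr₁ t ht, hr₂ t ht] with a ha₁ ha₂ hab
    obtain ⟨i₁, e₁⟩ := ha₁
    obtain ⟨i₂, e₂⟩ := ha₂
    have hsub : ∫ b, (k₁ t a b * f b - k₂ t a b * f b) = 0 := by
      rw [integral_sub i₁ i₂, ← e₁, ← e₂, hu, sub_self]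
    have hc : (fun b => k₁ t a b * f b - k₂ t a b * f b) =ᵐ[volume]
        (ball y ε).indicator fun b => k₁ t a b - k₂ t a b := by
      filter_upwards [hfae] with b hb
      rw [hb]
      by_cases hm : b ∈ ball y ε <;> simp [hm]
    have hint := (i₁.sub i₂).congr hc
    rw [integral_congr_ae hc, integral_indicator measurableSet_ball] at hsub
    have hpos := (setIntegral_pos_iff_support_of_nonneg_ae
      (ae_restrict_of_forall_mem measurableSet_ball fun b hb => by
        have := hmem a hab b hb
        simp only [Pi.zero_apply]; linarith)
      ((integrable_indicator_iff measurableSet_ball).1 hint)).2 (by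
        refine (measure_ball_pos volume y hε).trans_le (measure_mono fun b hb => ⟨?_, hb⟩)
        have := hmem a hab b hb
        exact (sub_pos.2 this).ne')
    linarith
  have h0 : volume (ball x ε) = 0 := by
    rw [ae_iff] at key
    simp only [not_not] at key
    exact key
  exact (measure_ball_pos volume x hε).ne' h0

theorem IsHeatKernel.heatKernel_eq {d : ℕ} {V : Eucl d → ℝ} (hV : ∀ x, 0 ≤ V x)
    (hVm : Measurable V) {k : ℝ → Eucl d → Eucl d → ℝ} (hk : IsHeatKernel V k) {t : ℝ}
    (ht : 0 < t) (x y : Eucl d) : heatKernel V t x y = k t x y := by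
  have hex : ∃ k, IsHeatKernel V k := ⟨k, hk⟩
  have hch := hex.choose_spec
  rw [heatKernel, dif_pos hex]
  exact le_antisymm (hch.le_of_isHeatKernel hV hVm hk ht x y)
    (hk.le_of_isHeatKernel hV hVm hch ht x y)

/-! ### Integral operators with Gaussian kernel bounds -/

noncomputable section

/-- The Gaussian `exp (-c |x|²)`. -/
def gauss {d : ℕ} (c : ℝ) (x : Eucl d) : ℝ := Real.exp (-c * ‖x‖ ^ 2)

end

theorem gauss_pos {d : ℕ} (c : ℝ) (x : Eucl d) : 0 < gauss c x := Real.exp_pos _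

theorem gauss_le_one {d : ℕ} {c : ℝ} (hc : 0 ≤ c) (x : Eucl d) : gauss c x ≤ 1 := by
  rw [gauss, Real.exp_le_one_iff]
  nlinarith [mul_nonneg hc (sq_nonneg ‖x‖)]

theorem continuous_gauss {d : ℕ} (c : ℝ) : Continuous (gauss c : Eucl d → ℝ) := by
  unfold gauss; fun_prop

theorem integrable_gauss {d : ℕ} {c : ℝ} (hc : 0 < c) :
    Integrable (gauss c : Eucl d → ℝ) volume := by
  -- The Bochner integral of a non-integrable function is `0` by convention, which contradicts the
  -- positive value of the Gaussian integral.
  by_contra h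
  have h0 := integral_undef h
  have h1 := GaussianFourier.integral_rexp_neg_mul_sq_norm (V := Eucl d) hc
  unfold gauss at h0
  rw [h0] at h1
  have : 0 < (Real.pi / c) ^ (Module.finrank ℝ (Eucl d) / 2 : ℝ) := by positivity
  linarith

theorem gauss_sq {d : ℕ} (c : ℝ) (x : Eucl d) : gauss c x ^ 2 = gauss (2 * c) x := by
  rw [gauss, gauss, ← Real.exp_nat_mul]
  congr 1
  push_cast
  ring

theorem memLp_gauss {d : ℕ} {c : ℝ} (hc : 0 < c) : MemLp (gauss c : Eucl d → ℝ) 2 volume := by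
  rw [memLp_two_iff_integrable_sq (continuous_gauss c).aestronglyMeasurable]
  simp only [gauss_sq]
  exact integrable_gauss (by linarith)

/-- A continuous kernel dominated by a Gaussian in both variables. -/
structure GaussianBound {d : ℕ} {F : Type*} [NormedAddCommGroup F] (K : Eucl d → Eucl d → F)
    (C c : ℝ) : Prop where
  continuous : Continuous fun q : Eucl d × Eucl d => K q.1 q.2
  pos : 0 < c
  bound : ∀ x y, ‖K x y‖ ≤ C * (gauss c x * gauss c y)

noncomputable section

/-- The integral operator with kernel `K`. -/
def intOp {d : ℕ} {F : Type*} [NormedAddCommGroup F] [NormedSpace ℝ F] (K : Eucl d → Eucl d → F)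
    (f : Eucl d → ℝ) (x : Eucl d) : F := ∫ y, f y • K x y

end

theorem integrable_abs_mul_gauss {d : ℕ} {f : Eucl d → ℝ} (hf : MemLp f 2 volume) {c : ℝ}
    (hc : 0 < c) : Integrable (fun y => |f y| * gauss c y) volume :=
  hf.norm.integrable_mul (memLp_gauss hc)

namespace GaussianBound

variable {d : ℕ} {F : Type*} [NormedAddCommGroup F] {K : Eucl d → Eucl d → F} {C c : ℝ}

theorem nonneg (h : GaussianBound K C c) : 0 ≤ C := by
  have h1 := (norm_nonneg _).trans (h.bound 0 0)
  have h2 := mul_pos (gauss_pos c (0 : Eucl d)) (gauss_pos c (0 : Eucl d))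
  exact nonneg_of_mul_nonneg_left h1 h2

variable [NormedSpace ℝ F]

theorem norm_smul_le (h : GaussianBound K C c) (f : Eucl d → ℝ) (x y : Eucl d) :
    ‖f y • K x y‖ ≤ C * gauss c x * (|f y| * gauss c y) := by
  rw [norm_smul, Real.norm_eq_abs]
  calc |f y| * ‖K x y‖ ≤ |f y| * (C * (gauss c x * gauss c y)) := by
        gcongr; exact h.bound x y
    _ = _ := by ring

theorem integrable_smul (h : GaussianBound K C c) {f : Eucl d → ℝ} (hf : MemLp f 2 volume)
    (x : Eucl d) : Integrable (fun y => f y • K x y) volume := by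
  refine Integrable.mono' ((integrable_abs_mul_gauss hf h.pos).const_mul (C * gauss c x))
    (hf.1.smul ?_) (Filter.Eventually.of_forall fun y => h.norm_smul_le f x y)
  exact (h.continuous.comp (by fun_prop : Continuous fun y : Eucl d => (x, y))).aestronglyMeasurable

theorem norm_intOp_le (h : GaussianBound K C c) {f : Eucl d → ℝ} (hf : MemLp f 2 volume)
    (x : Eucl d) : ‖intOp K f x‖ ≤ (C * ∫ y, |f y| * gauss c y) * gauss c x := by
  refine (norm_integral_le_of_norm_le
    ((integrable_abs_mul_gauss hf h.pos).const_mul (C * gauss c x))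
    (Filter.Eventually.of_forall fun y => h.norm_smul_le f x y)).trans_eq ?_
  rw [integral_const_mul]
  ring

theorem aestronglyMeasurable_smul (h : GaussianBound K C c) {f : Eucl d → ℝ}
    (hf : MemLp f 2 volume) :
    AEStronglyMeasurable (fun z : Eucl d × Eucl d => f z.2 • K z.1 z.2)
      ((volume : Measure (Eucl d)).prod volume) :=
  hf.1.comp_snd.smul h.continuous.aestronglyMeasurable

theorem memLp_intOp (h : GaussianBound K C c) {f : Eucl d → ℝ} (hf : MemLp f 2 volume) :
    MemLp (intOp K f) 2 volume := by
  refine MemLp.of_le ((memLp_gauss h.pos).const_mul (C * ∫ y, |f y| * gauss c y)) ?_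
    (Filter.Eventually.of_forall fun x => (h.norm_intOp_le hf x).trans (le_abs_self _))
  exact (h.aestronglyMeasurable_smul hf).integral_prod_right'

end GaussianBound

namespace GaussianBound

variable {d : ℕ} {F : Type*} [NormedAddCommGroup F] [InnerProductSpace ℝ F]
  {K : Eucl d → Eucl d → F} {C c : ℝ}

theorem integrable_inner_prod (h : GaussianBound K C c) {f : Eucl d → ℝ}
    (hf : MemLp f 2 volume) {H : Eucl d → F} (hH : MemLp H 2 volume) :
    Integrable (fun z : Eucl d × Eucl d => (inner ℝ (f z.2 • K z.1 z.2) (H z.1) : ℝ))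
      ((volume : Measure (Eucl d)).prod volume) := by
  refine Integrable.mono' ((((memLp_gauss h.pos).integrable_mul hH.norm).mul_prod
    (integrable_abs_mul_gauss hf h.pos)).const_mul C)
    ((h.aestronglyMeasurable_smul hf).inner hH.1.comp_fst)
    (Filter.Eventually.of_forall fun z => ?_)
  refine (norm_inner_le_norm _ _).trans ?_
  refine (mul_le_mul_of_nonneg_right (h.norm_smul_le f z.1 z.2) (norm_nonneg _)).trans_eq ?_
  simp only [Pi.mul_apply]
  ring

/-- Fubini, justified by the Gaussian bound. It carries identities known for each slice `K(·,y)`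
over to the operator: the weak gradient and the weak heat equation are both obtained this way. -/
theorem integral_inner_intOp [CompleteSpace F] (h : GaussianBound K C c) {f : Eucl d → ℝ}
    (hf : MemLp f 2 volume) {H : Eucl d → F} (hH : MemLp H 2 volume) :
    ∫ x, (inner ℝ (intOp K f x) (H x) : ℝ) = ∫ y, f y * ∫ x, (inner ℝ (K x y) (H x) : ℝ) := by
  have h1 : ∀ x, (inner ℝ (intOp K f x) (H x) : ℝ) = ∫ y, (inner ℝ (f y • K x y) (H x) : ℝ) := by
    intro x
    rw [real_inner_comm, intOp, ← integral_inner (h.integrable_smul hf x)]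
    simp only [real_inner_comm]
  simp only [h1]
  rw [integral_integral_swap (h.integrable_inner_prod hf hH)]
  refine integral_congr_ae (Filter.Eventually.of_forall fun y => ?_)
  simp only [real_inner_smul_left]
  rw [integral_const_mul]

end GaussianBound

theorem GaussianBound.integral_intOp_mul {d : ℕ} {K : Eucl d → Eucl d → ℝ} {C c : ℝ}
    (h : GaussianBound K C c) {f v : Eucl d → ℝ} (hf : MemLp f 2 volume) (hv : MemLp v 2 volume) :
    ∫ x, intOp K f x * v x = ∫ y, f y * ∫ x, K x y * v x := by
  have := h.integral_inner_intOp hf hv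
  simpa [mul_comm] using this

theorem L2.norm_sq_eq_integral {d : ℕ} (f : L2 d) : ‖f‖ ^ 2 = ∫ x, f x ^ 2 := by
  rw [← real_inner_self_eq_norm_sq, L2.inner_eq_integral_mul]
  simp only [sq]

/-! ### Differentiation in `L²` and test functions without compact support -/

/-- By the mean value inequality the difference quotients are bounded by `B` as well. Hence the
squared error is dominated by `4 B²` and tends to zero pointwise; dominated convergence turns this
into convergence in norm. -/
theorem hasDerivAt_L2_of_dominated {d : ℕ} {φ φ' : ℝ → Eucl d → ℝ} {t ε : ℝ} (hε : 0 < ε)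
    {F : ℝ → L2 d} {g : L2 d} {B : Eucl d → ℝ} (hB : MemLp B 2 volume)
    (hF : ∀ s ∈ ball t ε, F s =ᵐ[volume] φ s) (hg : g =ᵐ[volume] φ' t)
    (hφ : ∀ x, ∀ s ∈ ball t ε, HasDerivAt (fun s => φ s x) (φ' s x) s)
    (hbd : ∀ x, ∀ s ∈ ball t ε, |φ' s x| ≤ B x) : HasDerivAt F g t := by
  have htm : t ∈ ball t ε := mem_ball_self hε
  rw [hasDerivAt_iff_tendsto_slope, tendsto_iff_norm_sub_tendsto_zero]
  have hae : ∀ s ∈ ball t ε, (slope F t s - g : L2 d) =ᵐ[volume]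
      fun x => slope (fun s => φ s x) t s - φ' t x := by
    intro s hs
    filter_upwards [Lp.coeFn_sub (slope F t s) g, Lp.coeFn_smul (s - t)⁻¹ (F s - F t),
      Lp.coeFn_sub (F s) (F t), hF s hs, hF t htm, hg] with x h1 h2 h3 h4 h5 h6
    rw [h1, Pi.sub_apply, h6]
    congr 1
    rw [slope_def_module, h2, Pi.smul_apply, h3, Pi.sub_apply, h4, h5, slope_def_module]
  have hev : ∀ᶠ s in 𝓝[≠] t, s ∈ ball t ε :=
    mem_nhdsWithin_of_mem_nhds (isOpen_ball.mem_nhds htm)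
  have hlim : Filter.Tendsto (fun s => ∫ x, (slope (fun s => φ s x) t s - φ' t x) ^ 2) (𝓝[≠] t)
      (𝓝 (∫ _ : Eucl d, (0 : ℝ))) := by
    refine tendsto_integral_filter_of_dominated_convergence (fun x => 4 * B x ^ 2) ?_ ?_ ?_ ?_
    · filter_upwards [hev] with s hs
      exact ((Lp.aestronglyMeasurable _).congr (hae s hs)).pow 2
    · filter_upwards [hev, self_mem_nhdsWithin] with s hs hst
      refine Filter.Eventually.of_forall fun x => ?_
      have hsl : |slope (fun s => φ s x) t s| ≤ B x := by
        have := (convex_ball t ε).norm_image_sub_le_of_norm_hasDerivWithin_le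
          (fun r hr => (hφ x r hr).hasDerivWithinAt) (fun r hr => hbd x r hr) htm hs
        rw [slope_def_field, abs_div, div_le_iff₀ (abs_pos.2 (sub_ne_zero.2 hst))]
        exact this
      have h2 := hbd x t htm
      rw [Real.norm_eq_abs, abs_of_nonneg (sq_nonneg _)]
      have hB0 : 0 ≤ B x := (abs_nonneg _).trans h2
      have h3 : |slope (fun s => φ s x) t s - φ' t x| ≤ 2 * B x :=
        (abs_sub _ _).trans (by linarith)
      calc _ = |slope (fun s => φ s x) t s - φ' t x| ^ 2 := (sq_abs _).symm
        _ ≤ (2 * B x) ^ 2 := by gcongr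
        _ = _ := by ring
    · exact ((memLp_two_iff_integrable_sq hB.1).1 hB).const_mul 4
    · refine Filter.Eventually.of_forall fun x => ?_
      have := ((hasDerivAt_iff_tendsto_slope.1 (hφ x t htm)).sub_const (φ' t x)).pow 2
      simpa using this
  rw [integral_zero] at hlim
  have hsq : Filter.Tendsto (fun s => ‖slope F t s - g‖ ^ 2) (𝓝[≠] t) (𝓝 0) := by
    refine hlim.congr' ?_
    filter_upwards [hev] with s hs
    rw [L2.norm_sq_eq_integral]
    refine integral_congr_ae ?_
    filter_upwards [hae s hs] with x hx
    rw [hx]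
  simpa using hsq.sqrt

theorem exists_smooth_cutoff (d : ℕ) : ∃ b : Eucl d → ℝ, ContDiff ℝ ∞ b ∧ HasCompactSupport b ∧
    (∀ x, b x ∈ Icc 0 1) ∧ b 0 = 1 := by
  let b : ContDiffBump (0 : Eucl d) := ⟨1, 2, one_pos, one_lt_two⟩
  exact ⟨b, b.contDiff, b.hasCompactSupport, fun x => ⟨b.nonneg, b.le_one⟩,
    b.one_of_mem_closedBall (by simp [b.rIn_pos.le])⟩

/-- A weak gradient can be tested against smooth functions in `H¹`, without compact support. -/
theorem HasWeakGradient.integral_mul_fderiv {d : ℕ} {v : Eucl d → ℝ} {H : Eucl d → Eucl d}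
    (h : HasWeakGradient v H) (hv : MemLp v 2 volume) (hH : MemLp H 2 volume) {ψ : Eucl d → ℝ}
    (hψ : ContDiff ℝ ∞ ψ) (hψ2 : MemLp ψ 2 volume) (e : Eucl d)
    (hψ' : MemLp (fun x => fderiv ℝ ψ x e) 2 volume) :
    ∫ x, v x * fderiv ℝ ψ x e = - ∫ x, ψ x * inner ℝ (H x) e := by
  obtain ⟨b, hb, hbc, hb01, hb0⟩ := exists_smooth_cutoff d
  obtain ⟨M, hM⟩ : ∃ M, ∀ z, ‖fderiv ℝ b z‖ ≤ M :=
    (hbc.fderiv (𝕜 := ℝ)).exists_bound_of_continuous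
      (hb.continuous_fderiv (by simp))
  have hM0 : 0 ≤ M := (norm_nonneg _).trans (hM 0)
  set r : ℕ → ℝ := fun n => ((n : ℝ) + 1)⁻¹ with hr
  have hr0 : ∀ n, 0 < r n := fun n => by positivity
  have hr1 : ∀ n, r n ≤ 1 := fun n => inv_le_one_of_one_le₀ (by simp)
  have hrlim : Filter.Tendsto r Filter.atTop (𝓝 0) := by
    simpa [hr, one_div] using tendsto_one_div_add_atTop_nhds_zero_nat (𝕜 := ℝ)
  -- Cutoffs at scale `n + 1`: they tend to `1` pointwise, and the extra term of the product rule
  -- carries the factor `r n → 0`.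
  set χ : ℕ → Eucl d → ℝ := fun n x => b (r n • x) with hχ
  have hχs : ∀ n, ContDiff ℝ ∞ (χ n) := fun n => hb.comp (contDiff_const_smul (r n))
  have hχd : ∀ n x, fderiv ℝ (χ n) x e = r n * fderiv ℝ b (r n • x) e := by
    intro n x
    simp only [hχ]
    rw [fderiv_comp_smul]
    simp
  have hχc : ∀ n, HasCompactSupport (χ n) := fun n =>
    hbc.comp_smul (hr0 n).ne'
  have hd : ∀ n x, fderiv ℝ (fun x => χ n x * ψ x) x e
      = χ n x * fderiv ℝ ψ x e + ψ x * (r n * fderiv ℝ b (r n • x) e) := by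
    intro n x
    rw [fderiv_fun_mul ((hχs n).differentiable (by simp) x) (hψ.differentiable (by simp) x)]
    simp [hχd]
  have key : ∀ n, ∫ x, v x * (χ n x * fderiv ℝ ψ x e + ψ x * (r n * fderiv ℝ b (r n • x) e))
      = - ∫ x, (χ n x * ψ x) * inner ℝ (H x) e := by
    intro n
    have := h (fun x => χ n x * ψ x) ((hχs n).mul hψ) ((hχc n).mul_right) e
    simpa only [hd] using this
  have hχlim : ∀ x, Filter.Tendsto (fun n => χ n x) Filter.atTop (𝓝 1) := by
    intro x
    have h1 : Filter.Tendsto (fun n => r n • x) Filter.atTop (𝓝 ((0 : ℝ) • x)) :=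
      hrlim.smul_const x
    rw [zero_smul] at h1
    have h2 := (hb.continuous.tendsto 0).comp h1
    rwa [hb0] at h2
  have hχ0 : ∀ n x, |χ n x| ≤ 1 := fun n x => by
    rw [abs_of_nonneg (hb01 _).1]; exact (hb01 _).2
  have hχm : ∀ n, AEStronglyMeasurable (χ n) volume :=
    fun n => (hχs n).continuous.aestronglyMeasurable
  have hbm : ∀ n, AEStronglyMeasurable (fun x => r n * fderiv ℝ b (r n • x) e) volume :=
    fun n => Continuous.aestronglyMeasurable (by
      have := hb.continuous_fderiv (by simp)
      fun_prop)
  have hHe : MemLp (fun x => (inner ℝ (H x) e : ℝ)) 2 volume := hH.inner_const e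
  have l1 : Filter.Tendsto (fun n => ∫ x, v x * (χ n x * fderiv ℝ ψ x e
      + ψ x * (r n * fderiv ℝ b (r n • x) e))) Filter.atTop (𝓝 (∫ x, v x * fderiv ℝ ψ x e)) := by
    refine tendsto_integral_of_dominated_convergence
      (fun x => |v x| * |fderiv ℝ ψ x e| + |v x| * |ψ x| * (M * ‖e‖)) ?_ ?_ ?_ ?_
    · exact fun n => hv.1.mul (((hχm n).mul hψ'.1).add (hψ2.1.mul (hbm n)))
    · exact (hv.norm.integrable_mul hψ'.norm).add
        ((hv.norm.integrable_mul hψ2.norm).mul_const _)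
    · refine fun n => Filter.Eventually.of_forall fun x => ?_
      have h1 : |fderiv ℝ b (r n • x) e| ≤ M * ‖e‖ :=
        (ContinuousLinearMap.le_opNorm _ _).trans
          (mul_le_mul_of_nonneg_right (hM _) (norm_nonneg _))
      have h2 : |r n * fderiv ℝ b (r n • x) e| ≤ M * ‖e‖ := by
        rw [abs_mul, abs_of_pos (hr0 n)]
        calc _ ≤ 1 * (M * ‖e‖) := by gcongr; exact hr1 n
          _ = _ := one_mul _
      rw [Real.norm_eq_abs, abs_mul, mul_assoc, ← mul_add]
      refine mul_le_mul_of_nonneg_left ((abs_add_le _ _).trans ?_) (abs_nonneg _)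
      rw [abs_mul, abs_mul (ψ x)]
      refine add_le_add ?_ (mul_le_mul_of_nonneg_left h2 (abs_nonneg _))
      calc _ ≤ 1 * |fderiv ℝ ψ x e| := by gcongr; exact hχ0 n x
        _ = _ := one_mul _
    · refine Filter.Eventually.of_forall fun x => ?_
      have h2 : Filter.Tendsto (fun n => r n * fderiv ℝ b (r n • x) e) Filter.atTop (𝓝 0) := by
        refine hrlim.zero_mul_isBoundedUnder_le ?_
        refine Filter.isBoundedUnder_of ⟨M * ‖e‖, fun n => ?_⟩
        exact (ContinuousLinearMap.le_opNorm _ _).trans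
          (mul_le_mul_of_nonneg_right (hM _) (norm_nonneg _))
      simpa using (((hχlim x).mul_const (fderiv ℝ ψ x e)).add (h2.const_mul (ψ x))).const_mul (v x)
  have l2 : Filter.Tendsto (fun n => - ∫ x, (χ n x * ψ x) * inner ℝ (H x) e) Filter.atTop
      (𝓝 (- ∫ x, ψ x * inner ℝ (H x) e)) := by
    refine (tendsto_integral_of_dominated_convergence
      (fun x => |ψ x| * |inner ℝ (H x) e|) ?_ ?_ ?_ ?_).neg
    · exact fun n => ((hχm n).mul hψ2.1).mul hHe.1
    · exact hψ2.norm.integrable_mul hHe.norm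
    · refine fun n => Filter.Eventually.of_forall fun x => ?_
      rw [Real.norm_eq_abs, mul_assoc, abs_mul, abs_mul]
      calc _ ≤ 1 * (|ψ x| * |inner ℝ (H x) e|) := by gcongr; exact hχ0 n x
        _ = _ := one_mul _
    · refine Filter.Eventually.of_forall fun x => ?_
      simpa using ((hχlim x).mul_const (ψ x)).mul_const (inner ℝ (H x) e)
  simp only [key] at l1
  exact tendsto_nhds_unique l1 l2

/-! ### Mehler's kernel: derivatives and Gaussian bounds -/

noncomputable section

/-- The exponent in Mehler's formula. -/
def mehlerArg {d : ℕ} (t : ℝ) (x y : Eucl d) : ℝ :=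
  -(Real.cosh (2 * t) / (2 * Real.sinh (2 * t))) * (‖x‖ ^ 2 + ‖y‖ ^ 2)
    + inner ℝ x y / Real.sinh (2 * t)

/-- The normalisation in Mehler's formula. -/
def mehlerNorm (d : ℕ) (t : ℝ) : ℝ := (2 * Real.pi * Real.sinh (2 * t)) ^ (-(d / 2 : ℝ))

/-- Mehler's kernel for `-Δ + |x|²`. -/
def mehler (d : ℕ) (t : ℝ) (x y : Eucl d) : ℝ := mehlerNorm d t * Real.exp (mehlerArg t x y)

/-- The ratio of the time derivative of Mehler's kernel to the kernel. -/
def mehlerRate {d : ℕ} (t : ℝ) (x y : Eucl d) : ℝ :=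
  -(d * Real.cosh (2 * t) / Real.sinh (2 * t)) + (‖x‖ ^ 2 + ‖y‖ ^ 2) / Real.sinh (2 * t) ^ 2
    - 2 * Real.cosh (2 * t) / Real.sinh (2 * t) ^ 2 * inner ℝ x y

/-- The ratio of the spatial gradient of Mehler's kernel to the kernel. -/
def mehlerDrift {d : ℕ} (t : ℝ) (x y : Eucl d) : Eucl d :=
  (Real.sinh (2 * t))⁻¹ • y - (Real.cosh (2 * t) / Real.sinh (2 * t)) • x

end

theorem sinh_two_mul_pos {t : ℝ} (ht : 0 < t) : 0 < Real.sinh (2 * t) :=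
  Real.sinh_pos_iff.2 (by linarith)

theorem mehlerNorm_pos (d : ℕ) {t : ℝ} (ht : 0 < t) : 0 < mehlerNorm d t := by
  have := sinh_two_mul_pos ht
  unfold mehlerNorm
  positivity

theorem mehler_pos (d : ℕ) {t : ℝ} (ht : 0 < t) (x y : Eucl d) : 0 < mehler d t x y :=
  mul_pos (mehlerNorm_pos d ht) (Real.exp_pos _)

/-- Writing `2⟨x,y⟩ = |x|² + |y|² - |x-y|²` separates confinement from diffusion. Both terms are
nonpositive, so an upper bound may drop either one: dropping the second gives Gaussian decay in both
variables, dropping the first gives mass at most one. -/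
theorem mehlerArg_eq {d : ℕ} {t : ℝ} (ht : 0 < t) (x y : Eucl d) :
    mehlerArg t x y = -((Real.cosh (2 * t) - 1) / (2 * Real.sinh (2 * t))) * (‖x‖ ^ 2 + ‖y‖ ^ 2)
      - ‖x - y‖ ^ 2 / (2 * Real.sinh (2 * t)) := by
  have := (sinh_two_mul_pos ht).ne'
  rw [mehlerArg, norm_sub_sq_real]
  field_simp
  ring

theorem hasDerivAt_mehler (d : ℕ) {t : ℝ} (ht : 0 < t) (x y : Eucl d) :
    HasDerivAt (fun s => mehler d s x y) (mehlerRate t x y * mehler d t x y) t := by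
  have hS := sinh_two_mul_pos ht
  have h2 : HasDerivAt (fun s : ℝ => 2 * s) 2 t := by simpa using (hasDerivAt_id t).const_mul 2
  have dS : HasDerivAt (fun s => Real.sinh (2 * s)) (Real.cosh (2 * t) * 2) t := h2.sinh
  have dC : HasDerivAt (fun s => Real.cosh (2 * s)) (Real.sinh (2 * t) * 2) t := h2.cosh
  have dN : HasDerivAt (mehlerNorm d) (-(d * Real.cosh (2 * t) / Real.sinh (2 * t))
      * mehlerNorm d t) t := by
    have hb : 0 < 2 * Real.pi * Real.sinh (2 * t) := by positivity
    have := (dS.const_mul (2 * Real.pi)).rpow_const (p := -(d / 2 : ℝ)) (Or.inl hb.ne')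
    refine this.congr_deriv ?_
    rw [Real.rpow_sub_one hb.ne', mehlerNorm]
    field_simp
  have dA : HasDerivAt (fun s => mehlerArg s x y) ((‖x‖ ^ 2 + ‖y‖ ^ 2) / Real.sinh (2 * t) ^ 2
      - 2 * Real.cosh (2 * t) / Real.sinh (2 * t) ^ 2 * inner ℝ x y) t := by
    have := (((dC.div (dS.const_mul 2) (by positivity)).neg.mul_const (‖x‖ ^ 2 + ‖y‖ ^ 2))).add
      ((hasDerivAt_const t (inner ℝ x y : ℝ)).div dS hS.ne')
    refine this.congr_deriv ?_
    have hCS := Real.cosh_sq (2 * t)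
    field_simp
    rw [hCS]
    ring
  refine (dN.mul dA.exp).congr_deriv ?_
  rw [mehlerRate, mehler]
  ring

theorem hasFDerivAt_mehler (d : ℕ) {t : ℝ} (ht : 0 < t) (x y : Eucl d) :
    HasFDerivAt (fun x => mehler d t x y) (mehler d t x y • innerSL ℝ (mehlerDrift t x y)) x := by
  have hS := (sinh_two_mul_pos ht).ne'
  have h1 : HasFDerivAt (fun x : Eucl d => ‖x‖ ^ 2 + ‖y‖ ^ 2) (2 • innerSL ℝ x) x :=
    (hasStrictFDerivAt_norm_sq x).hasFDerivAt.add_const _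
  have h2 : HasFDerivAt (fun x : Eucl d => (inner ℝ x y : ℝ)) (innerSL ℝ y) x := by
    have := (innerSL ℝ y).hasFDerivAt (x := x)
    refine this.congr_of_eventuallyEq (Filter.Eventually.of_forall fun z => ?_)
    simp [real_inner_comm]
  have hA : HasFDerivAt (fun x => mehlerArg t x y) (innerSL ℝ (mehlerDrift t x y)) x := by
    have := (h1.const_mul (-(Real.cosh (2 * t) / (2 * Real.sinh (2 * t))))).add
      (h2.mul_const (Real.sinh (2 * t))⁻¹)
    simp only [← div_eq_mul_inv] at this
    refine this.congr_fderiv ?_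
    ext e
    simp only [mehlerDrift, map_sub, map_smul, add_apply,
      smul_apply, sub_apply, innerSL_apply_apply,
      smul_eq_mul, nsmul_eq_mul]
    field_simp
    push_cast
    ring
  have := hA.exp.const_mul (mehlerNorm d t)
  rw [smul_smul] at this
  exact this

theorem continuous_mehler_fst (d : ℕ) (t : ℝ) : Continuous fun q : Eucl d × Eucl d =>
    mehler d t q.1 q.2 := by
  unfold mehler mehlerArg
  fun_prop

theorem continuous_mehlerRate {d : ℕ} (t : ℝ) : Continuous fun q : Eucl d × Eucl d =>
    mehlerRate t q.1 q.2 := by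
  unfold mehlerRate
  fun_prop

theorem continuous_mehlerDrift {d : ℕ} (t : ℝ) : Continuous fun q : Eucl d × Eucl d =>
    mehlerDrift t q.1 q.2 := by
  unfold mehlerDrift
  fun_prop

theorem continuousOn_mehler (d : ℕ) :
    ContinuousOn (fun q : ℝ × Eucl d × Eucl d => mehler d q.1 q.2.1 q.2.2) (Ioi 0 ×ˢ univ) := by
  have hS : ∀ q ∈ (Ioi (0 : ℝ) ×ˢ (univ : Set (Eucl d × Eucl d))), Real.sinh (2 * q.1) ≠ 0 :=
    fun q hq => (sinh_two_mul_pos hq.1).ne'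
  have hS' : ∀ q ∈ (Ioi (0 : ℝ) ×ˢ (univ : Set (Eucl d × Eucl d))),
      2 * Real.sinh (2 * q.1) ≠ 0 := fun q hq => mul_ne_zero two_ne_zero (hS q hq)
  have hSc : ContinuousOn (fun q : ℝ × Eucl d × Eucl d => Real.sinh (2 * q.1)) (Ioi 0 ×ˢ univ) :=
    Continuous.continuousOn (by fun_prop)
  have hCc : ContinuousOn (fun q : ℝ × Eucl d × Eucl d => Real.cosh (2 * q.1)) (Ioi 0 ×ˢ univ) :=
    Continuous.continuousOn (by fun_prop)
  unfold mehler mehlerNorm mehlerArg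
  refine ContinuousOn.mul ((hSc.const_mul (2 * Real.pi)).rpow_const fun q hq => Or.inl ?_)
    (Real.continuous_exp.comp_continuousOn (((hCc.div (hSc.const_mul 2) hS').neg.mul ?_).add
    (ContinuousOn.div ?_ hSc hS)))
  · have := hS q hq
    positivity
  · exact Continuous.continuousOn (by fun_prop)
  · exact Continuous.continuousOn (by fun_prop)

theorem contDiff_mehler (d : ℕ) (t : ℝ) (y : Eucl d) : ContDiff ℝ ∞ fun x => mehler d t x y := by
  unfold mehler mehlerArg
  have h1 : ContDiff ℝ ∞ fun x : Eucl d => ‖x‖ ^ 2 := contDiff_norm_sq ℝ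
  have h2 : ContDiff ℝ ∞ fun x : Eucl d => (inner ℝ x y : ℝ) := contDiff_id.inner ℝ contDiff_const
  exact contDiff_const.mul ((contDiff_const.mul (h1.add contDiff_const)).add
    (h2.div_const _)).exp

theorem contDiff_mehlerDrift {d : ℕ} (t : ℝ) (y : Eucl d) :
    ContDiff ℝ ∞ fun x => mehlerDrift t x y := by
  unfold mehlerDrift
  exact contDiff_const.sub (contDiff_id.const_smul _)

theorem abs_mehlerRate_le {d : ℕ} {t a A : ℝ} (ha : 0 < a) (hS : a ≤ Real.sinh (2 * t))
    (hC : Real.cosh (2 * t) ≤ A) (x y : Eucl d) :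
    |mehlerRate t x y| ≤ (d * A / a + 1 / a ^ 2 + A / a ^ 2) * (1 + (‖x‖ ^ 2 + ‖y‖ ^ 2)) := by
  have hS0 : 0 < Real.sinh (2 * t) := ha.trans_le hS
  have hC0 : 0 < Real.cosh (2 * t) := Real.cosh_pos _
  have hA : 0 < A := hC0.trans_le hC
  set q := ‖x‖ ^ 2 + ‖y‖ ^ 2 with hq
  have hq0 : 0 ≤ q := by positivity
  have hin : 2 * |(inner ℝ x y : ℝ)| ≤ q := by
    have := abs_real_inner_le_norm x y
    nlinarith [sq_nonneg (‖x‖ - ‖y‖)]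
  have h1 : d * Real.cosh (2 * t) / Real.sinh (2 * t) ≤ d * A / a := by gcongr
  have h2 : q / Real.sinh (2 * t) ^ 2 ≤ 1 / a ^ 2 * q := by
    rw [one_div_mul_eq_div]; gcongr
  have h3 : |2 * Real.cosh (2 * t) / Real.sinh (2 * t) ^ 2 * inner ℝ x y| ≤ A / a ^ 2 * q := by
    rw [abs_mul, abs_of_pos (by positivity)]
    calc _ = Real.cosh (2 * t) / Real.sinh (2 * t) ^ 2 * (2 * |(inner ℝ x y : ℝ)|) := by ring
      _ ≤ _ := by gcongr
  have h1' : 0 ≤ d * Real.cosh (2 * t) / Real.sinh (2 * t) := by positivity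
  have h2' : 0 ≤ q / Real.sinh (2 * t) ^ 2 := by positivity
  have e1 : 0 ≤ d * A / a := by positivity
  have e2 : 0 ≤ 1 / a ^ 2 := by positivity
  have e3 : 0 ≤ A / a ^ 2 := by positivity
  have := abs_le.1 h3
  unfold mehlerRate
  rw [abs_le]
  constructor <;> nlinarith [mul_nonneg e1 hq0, mul_nonneg e2 hq0, mul_nonneg e3 hq0]

theorem norm_mehlerDrift_le {d : ℕ} {t : ℝ} (ht : 0 < t) (x y : Eucl d) :
    ‖mehlerDrift t x y‖ ≤ ((Real.sinh (2 * t))⁻¹ + Real.cosh (2 * t) / Real.sinh (2 * t))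
      * (1 + (‖x‖ ^ 2 + ‖y‖ ^ 2)) := by
  have hS := sinh_two_mul_pos ht
  have hC := Real.cosh_pos (2 * t)
  unfold mehlerDrift
  refine (norm_sub_le _ _).trans ?_
  rw [norm_smul, norm_smul, Real.norm_of_nonneg (by positivity),
    Real.norm_of_nonneg (by positivity), add_mul]
  gcongr
  · nlinarith [sq_nonneg (‖y‖ - 1), sq_nonneg ‖x‖]
  · nlinarith [sq_nonneg (‖x‖ - 1), sq_nonneg ‖y‖]

theorem mehler_le {d : ℕ} {t a δ : ℝ} (ht : 0 < t) (ha : 0 < a) (hS : a ≤ Real.sinh (2 * t))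
    (hδ : δ ≤ (Real.cosh (2 * t) - 1) / (2 * Real.sinh (2 * t))) (x y : Eucl d) :
    mehler d t x y ≤ (2 * Real.pi * a) ^ (-(d / 2 : ℝ))
      * Real.exp (-δ * (‖x‖ ^ 2 + ‖y‖ ^ 2)) := by
  have hS0 := sinh_two_mul_pos ht
  unfold mehler mehlerNorm
  rw [mehlerArg_eq ht]
  refine mul_le_mul (Real.rpow_le_rpow_of_nonpos (by positivity) (by gcongr)
    (neg_nonpos.2 (by positivity))) (Real.exp_le_exp.2 ?_) (Real.exp_pos _).le (by positivity)
  have h1 : 0 ≤ ‖x - y‖ ^ 2 / (2 * Real.sinh (2 * t)) := by positivity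
  have h2 : 0 ≤ ‖x‖ ^ 2 + ‖y‖ ^ 2 := by positivity
  nlinarith

/-- Half of the exponential decay pays for the polynomial factor. -/
theorem one_add_mul_exp_le {δ q : ℝ} (hδ : 0 < δ) (hq : 0 ≤ q) :
    (1 + q) * Real.exp (-δ * q) ≤ (1 + 2 / δ) * Real.exp (-(δ / 2) * q) := by
  have h1 : 1 + q ≤ (1 + 2 / δ) * Real.exp (δ / 2 * q) := by
    have := Real.add_one_le_exp (δ / 2 * q)
    calc 1 + q ≤ (1 + 2 / δ) * (δ / 2 * q + 1) := by
          have : (1 + 2 / δ) * (δ / 2 * q + 1) = δ / 2 * q + 1 + q + 2 / δ := by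
            field_simp
            ring
          rw [this]
          have : 0 ≤ δ / 2 * q := by positivity
          have : 0 ≤ 2 / δ := by positivity
          linarith
      _ ≤ _ := by gcongr
  calc (1 + q) * Real.exp (-δ * q) ≤ (1 + 2 / δ) * Real.exp (δ / 2 * q) * Real.exp (-δ * q) := by
        gcongr
    _ = _ := by
      rw [mul_assoc, ← Real.exp_add]
      ring_nf

theorem exp_neg_mul_eq_gauss_mul {d : ℕ} (c : ℝ) (x y : Eucl d) :
    Real.exp (-c * (‖x‖ ^ 2 + ‖y‖ ^ 2)) = gauss c x * gauss c y := by
  rw [gauss, gauss, ← Real.exp_add]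
  ring_nf

/-- Locally uniform in time Gaussian bounds for Mehler's kernel. -/
theorem exists_mehler_le (d : ℕ) {t : ℝ} (ht : 0 < t) : ∃ C c : ℝ, 0 ≤ C ∧ 0 < c ∧
    ∀ s ∈ ball t (t / 2), 0 < s ∧ ∀ x y : Eucl d,
      mehler d s x y * (1 + (‖x‖ ^ 2 + ‖y‖ ^ 2)) ≤ C * (gauss c x * gauss c y) ∧
      |mehlerRate s x y * mehler d s x y| ≤ C * (gauss c x * gauss c y) := by
  have ha : 0 < Real.sinh t := Real.sinh_pos_iff.2 ht
  -- For `s` in the ball, `2s` lies between `t` and `3t`. Hence `sinh t` and `cosh t` bound the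
  -- hyperbolic functions at `2s` from below, and their values at `4t` from above; `δ` takes the
  -- worst case in numerator and denominator separately.
  set A := Real.cosh (4 * t) with hA
  set δ := (Real.cosh t - 1) / (2 * Real.sinh (4 * t)) with hδ
  have hS4 : 0 < Real.sinh (4 * t) := Real.sinh_pos_iff.2 (by linarith)
  have hδ0 : 0 < δ := by
    have := Real.one_lt_cosh.2 ht.ne'
    exact div_pos (by linarith) (by linarith)
  set N := (2 * Real.pi * Real.sinh t) ^ (-(d / 2 : ℝ)) * (1 + 2 / δ) with hN
  have hN0 : 0 ≤ N := by positivity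
  set M := (d * A / Real.sinh t + 1 / Real.sinh t ^ 2 + A / Real.sinh t ^ 2) with hM
  have hM0 : 0 ≤ M := by positivity
  refine ⟨(1 + M) * N, δ / 2, by positivity, by positivity, fun s hs => ?_⟩
  rw [Real.ball_eq_Ioo] at hs
  have hs0 : 0 < s := by linarith [hs.1]
  have hS : Real.sinh t ≤ Real.sinh (2 * s) := Real.sinh_le_sinh.2 (by linarith [hs.1])
  have hS' : Real.sinh (2 * s) ≤ Real.sinh (4 * t) := Real.sinh_le_sinh.2 (by linarith [hs.2])
  have hC : Real.cosh (2 * s) ≤ A := Real.cosh_le_cosh.2 (by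
    rw [abs_of_pos (by linarith), abs_of_pos (by linarith)]; linarith [hs.2])
  have hC' : Real.cosh t ≤ Real.cosh (2 * s) := Real.cosh_le_cosh.2 (by
    rw [abs_of_pos (by linarith), abs_of_pos (by linarith)]; linarith [hs.1])
  have hδs : δ ≤ (Real.cosh (2 * s) - 1) / (2 * Real.sinh (2 * s)) := by
    have := Real.one_le_cosh t
    have := sinh_two_mul_pos hs0
    rw [hδ]
    gcongr
    linarith
  refine ⟨hs0, fun x y => ?_⟩
  have hq : 0 ≤ ‖x‖ ^ 2 + ‖y‖ ^ 2 := by positivity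
  have key : mehler d s x y * (1 + (‖x‖ ^ 2 + ‖y‖ ^ 2)) ≤ N * (gauss (δ / 2) x * gauss (δ / 2) y) := by
    rw [← exp_neg_mul_eq_gauss_mul]
    calc _ ≤ (2 * Real.pi * Real.sinh t) ^ (-(d / 2 : ℝ)) * Real.exp (-δ * (‖x‖ ^ 2 + ‖y‖ ^ 2))
          * (1 + (‖x‖ ^ 2 + ‖y‖ ^ 2)) := by
          gcongr
          exact mehler_le hs0 ha hS hδs x y
      _ = (2 * Real.pi * Real.sinh t) ^ (-(d / 2 : ℝ)) * ((1 + (‖x‖ ^ 2 + ‖y‖ ^ 2))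
          * Real.exp (-δ * (‖x‖ ^ 2 + ‖y‖ ^ 2))) := by ring
      _ ≤ (2 * Real.pi * Real.sinh t) ^ (-(d / 2 : ℝ)) * ((1 + 2 / δ)
          * Real.exp (-(δ / 2) * (‖x‖ ^ 2 + ‖y‖ ^ 2))) := by
          have := one_add_mul_exp_le hδ0 hq
          gcongr
      _ = _ := by rw [hN]; ring
  have hg : 0 ≤ gauss (δ / 2) x * gauss (δ / 2) y := (mul_pos (gauss_pos _ _) (gauss_pos _ _)).le
  constructor
  · refine key.trans ?_
    gcongr
    nlinarith
  · rw [abs_mul, abs_of_pos (mehler_pos d hs0 x y)]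
    calc _ ≤ M * (1 + (‖x‖ ^ 2 + ‖y‖ ^ 2)) * mehler d s x y := by
          gcongr
          · exact (mehler_pos d hs0 x y).le
          · exact abs_mehlerRate_le ha hS hC x y
      _ = M * (mehler d s x y * (1 + (‖x‖ ^ 2 + ‖y‖ ^ 2))) := by ring
      _ ≤ M * (N * (gauss (δ / 2) x * gauss (δ / 2) y)) := by gcongr
      _ ≤ _ := by nlinarith [mul_nonneg hN0 hg]

/-- A kernel with quadratic growth relative to Mehler's kernel has a Gaussian bound. -/
theorem exists_gaussianBound_of_le {d : ℕ} {F : Type*} [NormedAddCommGroup F] {t : ℝ} (ht : 0 < t)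
    {K : Eucl d → Eucl d → F} (hK : Continuous fun q : Eucl d × Eucl d => K q.1 q.2) {M : ℝ}
    (hM : ∀ x y, ‖K x y‖ ≤ M * (mehler d t x y * (1 + (‖x‖ ^ 2 + ‖y‖ ^ 2)))) :
    ∃ C c, GaussianBound K C c := by
  obtain ⟨C, c, hC, hc, h⟩ := exists_mehler_le d ht
  refine ⟨|M| * C, c, hK, hc, fun x y => (hM x y).trans ?_⟩
  have h1 := ((h t (mem_ball_self (by linarith))).2 x y).1
  have h2 : 0 ≤ mehler d t x y * (1 + (‖x‖ ^ 2 + ‖y‖ ^ 2)) :=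
    mul_nonneg (mehler_pos d ht x y).le (by positivity)
  calc _ ≤ |M| * (mehler d t x y * (1 + (‖x‖ ^ 2 + ‖y‖ ^ 2))) := by
        gcongr; exact le_abs_self M
    _ ≤ |M| * (C * (gauss c x * gauss c y)) := by gcongr
    _ = _ := by ring

theorem GaussianBound.memLp_slice {d : ℕ} {F : Type*} [NormedAddCommGroup F]
    {K : Eucl d → Eucl d → F} {C c : ℝ} (h : GaussianBound K C c) (y : Eucl d) :
    MemLp (fun x => K x y) 2 volume := by
  refine MemLp.of_le ((memLp_gauss h.pos).const_mul (C * gauss c y))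
    (h.continuous.comp (by fun_prop : Continuous fun x : Eucl d => (x, y))).aestronglyMeasurable
    (Filter.Eventually.of_forall fun x => (h.bound x y).trans ((le_abs_self _).trans_eq ?_))
  rw [Real.norm_eq_abs]
  ring_nf

noncomputable section

/-- The spatial gradient of Mehler's kernel. -/
def mehlerGrad {d : ℕ} (t : ℝ) (x y : Eucl d) : Eucl d := mehler d t x y • mehlerDrift t x y

/-- The time derivative of Mehler's kernel. -/
def mehlerDt {d : ℕ} (t : ℝ) (x y : Eucl d) : ℝ := mehlerRate t x y * mehler d t x y

end

theorem continuous_mehlerGrad {d : ℕ} (t : ℝ) : Continuous fun q : Eucl d × Eucl d =>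
    mehlerGrad t q.1 q.2 := (continuous_mehler_fst d t).smul (continuous_mehlerDrift t)

theorem continuous_mehlerDt {d : ℕ} (t : ℝ) : Continuous fun q : Eucl d × Eucl d =>
    mehlerDt t q.1 q.2 := (continuous_mehlerRate t).mul (continuous_mehler_fst d t)

theorem gaussianBound_mehler {d : ℕ} {t : ℝ} (ht : 0 < t) :
    ∃ C c, GaussianBound (mehler d t) C c := by
  refine exists_gaussianBound_of_le ht (continuous_mehler_fst d t) (M := 1) fun x y => ?_
  have h0 := mehler_pos d ht x y
  rw [Real.norm_of_nonneg h0.le, one_mul]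
  have : 0 ≤ ‖x‖ ^ 2 + ‖y‖ ^ 2 := by positivity
  nlinarith

theorem gaussianBound_norm_sq_mul_mehler {d : ℕ} {t : ℝ} (ht : 0 < t) :
    ∃ C c, GaussianBound (fun x y : Eucl d => ‖x‖ ^ 2 * mehler d t x y) C c := by
  refine exists_gaussianBound_of_le ht (by have := continuous_mehler_fst d t; fun_prop)
    (M := 1) fun x y => ?_
  have h0 := mehler_pos d ht x y
  rw [Real.norm_of_nonneg (by positivity), one_mul, mul_comm]
  gcongr
  nlinarith [sq_nonneg ‖y‖]

theorem gaussianBound_mehlerGrad {d : ℕ} {t : ℝ} (ht : 0 < t) :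
    ∃ C c, GaussianBound (mehlerGrad t : Eucl d → Eucl d → _) C c := by
  refine exists_gaussianBound_of_le ht (continuous_mehlerGrad t)
    (M := ((Real.sinh (2 * t))⁻¹ + Real.cosh (2 * t) / Real.sinh (2 * t))) fun x y => ?_
  have h0 := mehler_pos d ht x y
  rw [mehlerGrad, norm_smul, Real.norm_of_nonneg h0.le, mul_left_comm]
  gcongr
  exact norm_mehlerDrift_le ht x y

theorem gaussianBound_mehlerDt {d : ℕ} {t : ℝ} (ht : 0 < t) :
    ∃ C c, GaussianBound (mehlerDt t : Eucl d → Eucl d → _) C c := by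
  refine exists_gaussianBound_of_le ht (continuous_mehlerDt t)
    (M := d * Real.cosh (2 * t) / Real.sinh (2 * t) + 1 / Real.sinh (2 * t) ^ 2
      + Real.cosh (2 * t) / Real.sinh (2 * t) ^ 2) fun x y => ?_
  have h0 := mehler_pos d ht x y
  rw [mehlerDt, norm_mul, Real.norm_of_nonneg h0.le, mul_comm, mul_left_comm]
  gcongr
  exact abs_mehlerRate_le (sinh_two_mul_pos ht) le_rfl le_rfl x y

theorem norm_mehlerDrift_sq_le {d : ℕ} {t : ℝ} (x y : Eucl d) :
    ‖mehlerDrift t x y‖ ^ 2 ≤ 2 * (((Real.sinh (2 * t))⁻¹) ^ 2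
      + (Real.cosh (2 * t) / Real.sinh (2 * t)) ^ 2) * (1 + (‖x‖ ^ 2 + ‖y‖ ^ 2)) := by
  have h := norm_sub_le ((Real.sinh (2 * t))⁻¹ • y) ((Real.cosh (2 * t) / Real.sinh (2 * t)) • x)
  rw [norm_smul, norm_smul, Real.norm_eq_abs, Real.norm_eq_abs] at h
  set p := (Real.sinh (2 * t))⁻¹
  set q := Real.cosh (2 * t) / Real.sinh (2 * t)
  have h2 : ‖mehlerDrift t x y‖ ^ 2 ≤ (|p| * ‖y‖ + |q| * ‖x‖) ^ 2 := by
    gcongr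
    exact h
  have hp := sq_abs p
  have hq := sq_abs q
  have h3 : (|p| * ‖y‖ + |q| * ‖x‖) ^ 2 ≤ 2 * (p ^ 2 * ‖y‖ ^ 2 + q ^ 2 * ‖x‖ ^ 2) := by
    rw [← hp, ← hq]
    nlinarith [sq_nonneg (|p| * ‖y‖ - |q| * ‖x‖)]
  have : 0 ≤ p ^ 2 * ‖x‖ ^ 2 := by positivity
  have : 0 ≤ q ^ 2 * ‖y‖ ^ 2 := by positivity
  nlinarith [sq_nonneg p, sq_nonneg q]

/-- The kernel is the second derivative of Mehler's kernel along `e`, by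
`fderiv_inner_mehlerGrad_apply`. Its square integrability in `x` lets a component of the gradient
serve as a test function in `HasWeakGradient.integral_mul_fderiv`. -/
theorem gaussianBound_mehler_second {d : ℕ} {t : ℝ} (ht : 0 < t) (e : Eucl d) :
    ∃ C c, GaussianBound (fun x y : Eucl d =>
    mehler d t x y * ((inner ℝ (mehlerDrift t x y) e) ^ 2
      - Real.cosh (2 * t) / Real.sinh (2 * t) * ‖e‖ ^ 2)) C c := by
  refine exists_gaussianBound_of_le ht (by
    have := continuous_mehler_fst d t
    have := continuous_mehlerDrift (d := d) t
    fun_prop)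
    (M := (2 * (((Real.sinh (2 * t))⁻¹) ^ 2 + (Real.cosh (2 * t) / Real.sinh (2 * t)) ^ 2)
      + Real.cosh (2 * t) / Real.sinh (2 * t)) * ‖e‖ ^ 2) fun x y => ?_
  have h0 := mehler_pos d ht x y
  have hα : 0 < Real.cosh (2 * t) / Real.sinh (2 * t) :=
    div_pos (Real.cosh_pos _) (sinh_two_mul_pos ht)
  rw [norm_mul, Real.norm_of_nonneg h0.le, mul_left_comm]
  gcongr
  refine (norm_sub_le _ _).trans ?_
  rw [Real.norm_of_nonneg (by positivity), Real.norm_of_nonneg (by positivity)]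
  have h1 : (inner ℝ (mehlerDrift t x y) e : ℝ) ^ 2 ≤ ‖mehlerDrift t x y‖ ^ 2 * ‖e‖ ^ 2 := by
    rw [← mul_pow, ← sq_abs]
    gcongr
    exact abs_real_inner_le_norm _ _
  have h2 := mul_le_mul_of_nonneg_right (norm_mehlerDrift_sq_le (t := t) x y) (sq_nonneg ‖e‖)
  have h3 : 0 ≤ Real.cosh (2 * t) / Real.sinh (2 * t) * ‖e‖ ^ 2 * (‖x‖ ^ 2 + ‖y‖ ^ 2) := by
    positivity
  nlinarith

/-! ### The heat equation for Mehler's kernel, in weak form -/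

theorem fderiv_mehler_apply {d : ℕ} {t : ℝ} (ht : 0 < t) (x y e : Eucl d) :
    fderiv ℝ (fun x => mehler d t x y) x e = inner ℝ (mehlerGrad t x y) e := by
  rw [(hasFDerivAt_mehler d ht x y).fderiv, mehlerGrad, real_inner_smul_left]
  simp

theorem fderiv_inner_mehlerGrad_apply {d : ℕ} {t : ℝ} (ht : 0 < t) (x y e : Eucl d) :
    fderiv ℝ (fun x => (inner ℝ (mehlerGrad t x y) e : ℝ)) x e
      = mehler d t x y * ((inner ℝ (mehlerDrift t x y) e) ^ 2
        - Real.cosh (2 * t) / Real.sinh (2 * t) * ‖e‖ ^ 2) := by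
  have h1 : HasFDerivAt (fun x : Eucl d => (inner ℝ (mehlerDrift t x y) e : ℝ))
      (-((Real.cosh (2 * t) / Real.sinh (2 * t)) • innerSL ℝ e)) x := by
    have := (((innerSL ℝ e).hasFDerivAt (x := x)).const_mul
      (Real.cosh (2 * t) / Real.sinh (2 * t))).const_sub
      (inner ℝ ((Real.sinh (2 * t))⁻¹ • y) e)
    refine this.congr_of_eventuallyEq (Filter.Eventually.of_forall fun z => ?_)
    change (inner ℝ ((Real.sinh (2 * t))⁻¹ • y - (Real.cosh (2 * t) / Real.sinh (2 * t)) • z) e : ℝ)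
      = _
    rw [inner_sub_left, real_inner_smul_left z, real_inner_comm e z]
    rfl
  have h2 := ((hasFDerivAt_mehler d ht x y).fun_mul h1).fderiv
  have h3 : (fun x => (inner ℝ (mehlerGrad t x y) e : ℝ))
      = fun x => mehler d t x y * inner ℝ (mehlerDrift t x y) e := by
    funext x
    rw [mehlerGrad, real_inner_smul_left]
  rw [h3, h2]
  simp only [add_apply, smul_apply, neg_apply, innerSL_apply_apply, smul_eq_mul,
    real_inner_self_eq_norm_sq]
  ring

theorem contDiff_mehlerGrad {d : ℕ} {t : ℝ} (y : Eucl d) : ContDiff ℝ ∞ fun x => mehlerGrad t x y :=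
  (contDiff_mehler d t y).smul (contDiff_mehlerDrift t y)

theorem integral_mehler_mul_fderiv {d : ℕ} {t : ℝ} (ht : 0 < t) (y : Eucl d)
    {φ : Eucl d → ℝ} (hφ : ContDiff ℝ ∞ φ)
    (hφc : HasCompactSupport φ) (e : Eucl d) :
    ∫ x, mehler d t x y * fderiv ℝ φ x e = - ∫ x, inner ℝ (mehlerGrad t x y) e * φ x := by
  have hk := contDiff_mehler d t y
  have hG := (contDiff_mehlerGrad (t := t) y).continuous
  have hφ' := hφ.continuous_fderiv (by simp)
  have := integral_mul_fderiv_eq_neg_fderiv_mul_of_integrable (μ := (volume : Measure (Eucl d)))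
    (f := fun x => mehler d t x y) (g := φ) (v := e) ?_ ?_ ?_
    (fun x _ => hk.differentiable (by simp) x) (fun x _ => hφ.differentiable (by simp) x)
  · simpa only [fderiv_mehler_apply ht] using this
  · simp only [fderiv_mehler_apply ht]
    refine Continuous.integrable_of_hasCompactSupport ?_ hφc.mul_left
    exact (hG.inner continuous_const).mul hφ.continuous
  · refine Continuous.integrable_of_hasCompactSupport
      (hk.continuous.mul (hφ'.clm_apply continuous_const)) (HasCompactSupport.mul_left ?_)
    exact (hφc.fderiv (𝕜 := ℝ)).comp_left (g := fun L : Eucl d →L[ℝ] ℝ => L e) (by simp)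
  · exact Continuous.integrable_of_hasCompactSupport (hk.continuous.mul hφ.continuous)
      hφc.mul_left

/-- This is the equation `Δk = ∂ₜk + |x|² k` divided by `k`: the left side is `Δk / k`, since the
drift is `∇ log k` and has divergence `-d coth 2t`. It reduces to `cosh² - sinh² = 1`. -/
theorem norm_mehlerDrift_sq {d : ℕ} {t : ℝ} (ht : 0 < t) (x y : Eucl d) :
    ‖mehlerDrift t x y‖ ^ 2 - d * (Real.cosh (2 * t) / Real.sinh (2 * t))
      = mehlerRate t x y + ‖x‖ ^ 2 := by
  have hS := (sinh_two_mul_pos ht).ne'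
  rw [mehlerDrift, norm_sub_sq_real, norm_smul, norm_smul, real_inner_smul_left,
    real_inner_smul_right, mul_pow, mul_pow, Real.norm_eq_abs, Real.norm_eq_abs, sq_abs, sq_abs,
    mehlerRate, real_inner_comm]
  have hCS := Real.cosh_sq (2 * t)
  field_simp
  rw [hCS]
  ring

/-- For fixed `y`, Mehler's kernel solves the heat equation in the weak sense. -/
theorem integral_inner_mehlerGrad {d : ℕ} {t : ℝ} (ht : 0 < t) (y : Eucl d)
    {v : Eucl d → ℝ} {H : Eucl d → Eucl d}
    (h : HasWeakGradient v H) (hv : MemLp v 2 volume) (hH : MemLp H 2 volume) :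
    (∫ x, (inner ℝ (mehlerGrad t x y) (H x) : ℝ)) + ∫ x, (‖x‖ ^ 2 * mehler d t x y) * v x
      = - ∫ x, mehlerDt t x y * v x := by
  obtain ⟨C₁, c₁, hG⟩ := gaussianBound_mehlerGrad (d := d) ht
  obtain ⟨C₂, c₂, hD⟩ := gaussianBound_mehlerDt (d := d) ht
  obtain ⟨C₃, c₃, hQ⟩ := gaussianBound_norm_sq_mul_mehler (d := d) ht
  let b := EuclideanSpace.basisFun (Fin d) ℝ
  set α := Real.cosh (2 * t) / Real.sinh (2 * t) with hα
  -- The `i`-th component of the kernel's gradient is the test function, in its own direction;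
  -- summing over `i` produces the Laplacian of the kernel.
  have hi : ∀ i, ∫ x, v x * (mehler d t x y * ((inner ℝ (mehlerDrift t x y) (b i)) ^ 2
        - α * ‖b i‖ ^ 2))
      = - ∫ x, inner ℝ (mehlerGrad t x y) (b i) * inner ℝ (H x) (b i) := by
    intro i
    obtain ⟨C₄, c₄, hE⟩ := gaussianBound_mehler_second ht (b i)
    have := h.integral_mul_fderiv hv hH (ψ := fun x => inner ℝ (mehlerGrad t x y) (b i))
      ((contDiff_mehlerGrad y).inner ℝ contDiff_const) ((hG.memLp_slice y).inner_const _) (b i)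
      (by simpa only [fderiv_inner_mehlerGrad_apply ht] using hE.memLp_slice y)
    simpa only [fderiv_inner_mehlerGrad_apply ht] using this
  have hs1 : ∫ x, (inner ℝ (mehlerGrad t x y) (H x) : ℝ)
      = ∑ i, ∫ x, inner ℝ (mehlerGrad t x y) (b i) * inner ℝ (H x) (b i) := by
    rw [← integral_finsetSum]
    · refine integral_congr_ae (Filter.Eventually.of_forall fun x => ?_)
      simp only
      rw [← b.sum_inner_mul_inner]
      refine Finset.sum_congr rfl fun i _ => ?_
      rw [real_inner_comm (H x)]
    · exact fun i _ => ((hG.memLp_slice y).inner_const _).integrable_mul (hH.inner_const _)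
  have hs2 : ∑ i, ∫ x, v x * (mehler d t x y * ((inner ℝ (mehlerDrift t x y) (b i)) ^ 2
        - α * ‖b i‖ ^ 2))
      = ∫ x, (mehlerDt t x y * v x + (‖x‖ ^ 2 * mehler d t x y) * v x) := by
    rw [← integral_finsetSum]
    · refine integral_congr_ae (Filter.Eventually.of_forall fun x => ?_)
      simp only
      have e1 : ∑ i, (inner ℝ (mehlerDrift t x y) (b i) : ℝ) ^ 2 = ‖mehlerDrift t x y‖ ^ 2 := by
        rw [← b.sum_sq_norm_inner_left (mehlerDrift t x y)]
        refine Finset.sum_congr rfl fun i _ => ?_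
        rw [Real.norm_eq_abs, sq_abs]
      have e2 : ∑ i, α * ‖b i‖ ^ 2 = d * α := by
        simp
      rw [← Finset.mul_sum, ← Finset.mul_sum, Finset.sum_sub_distrib, e1, e2,
        norm_mehlerDrift_sq ht, mehlerDt]
      ring
    · intro i _
      obtain ⟨C₄, c₄, hE⟩ := gaussianBound_mehler_second ht (b i)
      exact hv.integrable_mul (hE.memLp_slice y)
  have i1 : Integrable (fun x => mehlerDt t x y * v x) volume :=
    (hD.memLp_slice y).integrable_mul hv
  have i2 : Integrable (fun x => (‖x‖ ^ 2 * mehler d t x y) * v x) volume :=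
    (hQ.memLp_slice y).integrable_mul hv
  rw [integral_add i1 i2] at hs2
  simp only [hi, Finset.sum_neg_distrib] at hs2
  linarith

/-! ### Contractivity and strong continuity at time zero -/

/-- Schur's test, in bilinear form. -/
theorem GaussianBound.integral_intOp_mul_le {d : ℕ} {K : Eucl d → Eucl d → ℝ} {C c : ℝ}
    (h : GaussianBound K C c) (h0 : ∀ x y, 0 ≤ K x y) (h1 : ∀ y, ∫ x, K x y ≤ 1)
    (h2 : ∀ x, ∫ y, K x y ≤ 1) {f v : Eucl d → ℝ} (hf : MemLp f 2 volume)
    (hv : MemLp v 2 volume) :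
    ∫ x, intOp K f x * v x ≤ 1 / 2 * ((∫ x, f x ^ 2) + ∫ x, v x ^ 2) := by
  have hf2 := (memLp_two_iff_integrable_sq hf.1).1 hf
  have hv2 := (memLp_two_iff_integrable_sq hv.1).1 hv
  have hK : AEStronglyMeasurable (fun z : Eucl d × Eucl d => K z.1 z.2)
      ((volume : Measure (Eucl d)).prod volume) := h.continuous.aestronglyMeasurable
  have hKle : ∀ x y, ‖K x y‖ ≤ C * (gauss c x * gauss c y) := h.bound
  have i1 : Integrable (fun z : Eucl d × Eucl d => f z.2 ^ 2 * K z.1 z.2)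
      ((volume : Measure (Eucl d)).prod volume) := by
    refine Integrable.mono' (((integrable_gauss h.pos).mul_prod hf2).const_mul C)
      ((hf.1.comp_snd.pow 2).mul hK) (Filter.Eventually.of_forall fun z => ?_)
    rw [norm_mul, Real.norm_of_nonneg (sq_nonneg _)]
    calc _ ≤ f z.2 ^ 2 * (C * (gauss c z.1 * 1)) := by
          gcongr
          refine (hKle _ _).trans ?_
          have := h.nonneg
          have := (gauss_pos c z.1).le
          gcongr
          exact gauss_le_one h.pos.le _
      _ = _ := by ring
  have i2 : Integrable (fun z : Eucl d × Eucl d => v z.1 ^ 2 * K z.1 z.2)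
      ((volume : Measure (Eucl d)).prod volume) := by
    refine Integrable.mono' ((hv2.mul_prod (integrable_gauss h.pos)).const_mul C)
      ((hv.1.comp_fst.pow 2).mul hK) (Filter.Eventually.of_forall fun z => ?_)
    rw [norm_mul, Real.norm_of_nonneg (sq_nonneg _)]
    calc _ ≤ v z.1 ^ 2 * (C * (1 * gauss c z.2)) := by
          gcongr
          refine (hKle _ _).trans ?_
          have := h.nonneg
          have := (gauss_pos c z.2).le
          gcongr
          exact gauss_le_one h.pos.le _
      _ = _ := by ring
  have i3 : Integrable (fun z : Eucl d × Eucl d => (f z.2 * K z.1 z.2) * v z.1)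
      ((volume : Measure (Eucl d)).prod volume) := by
    have := h.integrable_inner_prod hf hv
    simpa [mul_comm] using this
  have e0 : ∫ x, intOp K f x * v x
      = ∫ z, (f z.2 * K z.1 z.2) * v z.1 ∂((volume : Measure (Eucl d)).prod volume) := by
    rw [integral_prod _ i3]
    simp only [integral_mul_const]
    rfl
  have e1 : ∫ z, f z.2 ^ 2 * K z.1 z.2 ∂((volume : Measure (Eucl d)).prod volume)
      ≤ ∫ y, f y ^ 2 := by
    rw [integral_prod_symm _ i1]
    refine integral_mono i1.integral_prod_right hf2 fun y => ?_
    simp only [integral_const_mul]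
    exact mul_le_of_le_one_right (sq_nonneg _) (h1 y)
  have e2 : ∫ z, v z.1 ^ 2 * K z.1 z.2 ∂((volume : Measure (Eucl d)).prod volume)
      ≤ ∫ x, v x ^ 2 := by
    rw [integral_prod _ i2]
    refine integral_mono i2.integral_prod_left hv2 fun x => ?_
    simp only [integral_const_mul]
    exact mul_le_of_le_one_right (sq_nonneg _) (h2 x)
  have e3 : ∫ z, (f z.2 * K z.1 z.2) * v z.1 ∂((volume : Measure (Eucl d)).prod volume)
      ≤ ∫ z, 1 / 2 * (f z.2 ^ 2 * K z.1 z.2 + v z.1 ^ 2 * K z.1 z.2)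
        ∂((volume : Measure (Eucl d)).prod volume) := by
    refine integral_mono i3 ((i1.add i2).const_mul _) fun z => ?_
    have := mul_nonneg (h0 z.1 z.2) (sq_nonneg (f z.2 - v z.1))
    simp only
    nlinarith
  rw [integral_const_mul, integral_add i1 i2] at e3
  linarith

theorem mehlerArg_comm {d : ℕ} (t : ℝ) (x y : Eucl d) : mehlerArg t x y = mehlerArg t y x := by
  rw [mehlerArg, mehlerArg, real_inner_comm, add_comm (‖x‖ ^ 2)]

theorem mehler_comm (d : ℕ) (t : ℝ) (x y : Eucl d) : mehler d t x y = mehler d t y x := by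
  rw [mehler, mehler, mehlerArg_comm]

theorem GaussianBound.integrable_slice {d : ℕ} {K : Eucl d → Eucl d → ℝ} {C c : ℝ}
    (h : GaussianBound K C c) (y : Eucl d) : Integrable (fun x => K x y) volume := by
  refine Integrable.mono' ((integrable_gauss h.pos).const_mul (C * gauss c y))
    (h.continuous.comp (by fun_prop : Continuous fun x : Eucl d => (x, y))).aestronglyMeasurable
    (Filter.Eventually.of_forall fun x => (h.bound x y).trans_eq ?_)
  ring

/-- Without the confining term the kernel is a Gaussian in `x - y`, of total mass exactly `1` thanks
to the factor `mehlerNorm`. -/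
theorem integral_mehler_le_one {d : ℕ} {t : ℝ} (ht : 0 < t) (y : Eucl d) :
    ∫ x, mehler d t x y ≤ 1 := by
  have hS := sinh_two_mul_pos ht
  obtain ⟨C, c, hK⟩ := gaussianBound_mehler (d := d) ht
  set b := 1 / (2 * Real.sinh (2 * t)) with hb
  have hb0 : 0 < b := by positivity
  have h1 : ∫ x : Eucl d, gauss b (x - y) = (Real.pi / b) ^ (d / 2 : ℝ) := by
    rw [integral_sub_right_eq_self (fun x => gauss b x) y]
    have := GaussianFourier.integral_rexp_neg_mul_sq_norm (V := Eucl d) hb0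
    rw [finrank_euclideanSpace_fin] at this
    exact this
  calc ∫ x, mehler d t x y ≤ ∫ x : Eucl d, mehlerNorm d t * gauss b (x - y) := by
        refine integral_mono (hK.integrable_slice y)
          (((integrable_gauss hb0).comp_sub_right y).const_mul _) fun x => ?_
        simp only [mehler, gauss]
        rw [mehlerArg_eq ht]
        have := mehlerNorm_pos d ht
        gcongr
        have h2 : 0 ≤ (Real.cosh (2 * t) - 1) / (2 * Real.sinh (2 * t)) * (‖x‖ ^ 2 + ‖y‖ ^ 2) := by
          have := Real.one_le_cosh (2 * t)
          have : 0 ≤ Real.cosh (2 * t) - 1 := by linarith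
          positivity
        have h3 : b * ‖x - y‖ ^ 2 = ‖x - y‖ ^ 2 / (2 * Real.sinh (2 * t)) := by
          rw [hb]; ring
        linarith
    _ = mehlerNorm d t * (Real.pi / b) ^ (d / 2 : ℝ) := by rw [integral_const_mul, h1]
    _ = 1 := by
        have h4 : Real.pi / b = 2 * Real.pi * Real.sinh (2 * t) := by
          rw [hb]; field_simp
        rw [h4, mehlerNorm, Real.rpow_neg (by positivity)]
        exact inv_mul_cancel₀ (by positivity)
    _ ≤ 1 := le_rfl

theorem integral_mehler_le_one' {d : ℕ} {t : ℝ} (ht : 0 < t) (x : Eucl d) :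
    ∫ y, mehler d t x y ≤ 1 := by
  simp only [mehler_comm d t x]
  exact integral_mehler_le_one ht x

/-- The half-angle form `tanh t / 2` has no `0/0` at `t = 0`, so the limit of small times becomes
plain continuity. -/
theorem cosh_sub_one_div_sinh {t : ℝ} (ht : 0 < t) :
    (Real.cosh (2 * t) - 1) / (2 * Real.sinh (2 * t)) = Real.sinh t / (2 * Real.cosh t) := by
  have h1 := Real.cosh_pos t
  have h2 : 0 < Real.sinh t := Real.sinh_pos_iff.2 ht
  rw [Real.sinh_two_mul, Real.cosh_two_mul, Real.cosh_sq]
  field_simp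
  ring

/-- The change of variables `y = x + (sinh 2t)^{1/2} z` in Mehler's formula. -/
theorem intOp_mehler_eq {d : ℕ} {t : ℝ} (ht : 0 < t) (f : Eucl d → ℝ) (x : Eucl d) :
    intOp (mehler d t) f x = ∫ z : Eucl d, f (x + √(Real.sinh (2 * t)) • z)
      * ((2 * Real.pi) ^ (-(d / 2 : ℝ)) * (Real.exp (-(Real.sinh t / (2 * Real.cosh t))
        * (‖x‖ ^ 2 + ‖x + √(Real.sinh (2 * t)) • z‖ ^ 2)) * gauss (1 / 2) z)) := by
  have hS := sinh_two_mul_pos ht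
  set R := √(Real.sinh (2 * t)) with hR
  have hR0 : 0 < R := Real.sqrt_pos.2 hS
  have hR2 : R ^ 2 = Real.sinh (2 * t) := Real.sq_sqrt hS.le
  have hN : mehlerNorm d t = (R ^ d)⁻¹ * (2 * Real.pi) ^ (-(d / 2 : ℝ)) := by
    rw [mehlerNorm, Real.mul_rpow (by positivity) hS.le, ← hR2, mul_comm]
    congr 1
    rw [← Real.rpow_natCast, ← Real.rpow_natCast, ← Real.rpow_mul hR0.le, ← Real.rpow_neg hR0.le]
    congr 1
    push_cast
    ring
  have e1 : intOp (mehler d t) f x = ∫ w : Eucl d, f (x + w) * mehler d t x (x + w) := by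
    rw [integral_add_left_eq_self (fun y => f y * mehler d t x y) x]
    rfl
  have e2 := Measure.integral_comp_smul (volume : Measure (Eucl d))
    (fun w => f (x + w) * mehler d t x (x + w)) R
  rw [finrank_euclideanSpace_fin, abs_of_pos (by positivity), smul_eq_mul] at e2
  have e3 : intOp (mehler d t) f x
      = R ^ d * ∫ z : Eucl d, f (x + R • z) * mehler d t x (x + R • z) := by
    rw [e2, e1, ← mul_assoc, mul_inv_cancel₀ (by positivity), one_mul]
  rw [e3, ← integral_const_mul]
  refine integral_congr_ae (Filter.Eventually.of_forall fun z => ?_)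
  simp only
  rw [mehler, mehlerArg_eq ht, hN, cosh_sub_one_div_sinh ht, sub_eq_add_neg, Real.exp_add]
  have e4 : -(‖x - (x + R • z)‖ ^ 2 / (2 * Real.sinh (2 * t))) = -(1 / 2) * ‖z‖ ^ 2 := by
    rw [sub_add_cancel_left, norm_neg, norm_smul, mul_pow, Real.norm_eq_abs, sq_abs, hR2]
    field_simp
  rw [e4, gauss]
  field_simp

theorem integral_gauss_half (d : ℕ) :
    (2 * Real.pi) ^ (-(d / 2 : ℝ)) * ∫ z : Eucl d, gauss (1 / 2) z = 1 := by
  have := GaussianFourier.integral_rexp_neg_mul_sq_norm (V := Eucl d) (b := 1 / 2) (by norm_num)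
  rw [finrank_euclideanSpace_fin] at this
  unfold gauss
  rw [this, Real.rpow_neg (by positivity), show Real.pi / (1 / 2) = 2 * Real.pi by ring]
  exact inv_mul_cancel₀ (by positivity)

/-- After the change of variables the integrand is continuous in `t` down to `t = 0` and dominated
by `M` times a fixed normalised Gaussian. -/
theorem tendsto_intOp_mehler {d : ℕ} {f : Eucl d → ℝ} (hf : Continuous f) {M : ℝ}
    (hM : ∀ x, |f x| ≤ M) (x : Eucl d) :
    Filter.Tendsto (fun t => intOp (mehler d t) f x) (𝓝[>] 0) (𝓝 (f x)) := by
  have hlim : Filter.Tendsto (fun t : ℝ => ∫ z : Eucl d, f (x + √(Real.sinh (2 * t)) • z)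
      * ((2 * Real.pi) ^ (-(d / 2 : ℝ)) * (Real.exp (-(Real.sinh t / (2 * Real.cosh t))
        * (‖x‖ ^ 2 + ‖x + √(Real.sinh (2 * t)) • z‖ ^ 2)) * gauss (1 / 2) z))) (𝓝[>] 0)
      (𝓝 (∫ z : Eucl d, f x * ((2 * Real.pi) ^ (-(d / 2 : ℝ)) * gauss (1 / 2) z))) := by
    have hg := continuous_gauss (d := d) (1 / 2)
    refine tendsto_integral_filter_of_dominated_convergence
      (fun z => M * ((2 * Real.pi) ^ (-(d / 2 : ℝ)) * gauss (1 / 2) z)) ?_ ?_ ?_ ?_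
    · exact Filter.Eventually.of_forall fun t => Continuous.aestronglyMeasurable (by fun_prop)
    · filter_upwards [self_mem_nhdsWithin] with t ht
      refine Filter.Eventually.of_forall fun z => ?_
      have hgz := gauss_pos (1 / 2) z
      have hM0 : 0 ≤ M := (abs_nonneg _).trans (hM 0)
      have hc := Real.cosh_pos t
      have hs : 0 < Real.sinh t := Real.sinh_pos_iff.2 ht
      rw [norm_mul, Real.norm_eq_abs, Real.norm_of_nonneg (by positivity)]
      gcongr
      · exact hM _
      · refine mul_le_of_le_one_left hgz.le (Real.exp_le_one_iff.2 ?_)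
        rw [neg_mul]
        exact neg_nonpos.2 (by positivity)
    · exact ((integrable_gauss (by norm_num)).const_mul _).const_mul _
    · refine Filter.Eventually.of_forall fun z => ?_
      have hcosh : ∀ t : ℝ, 2 * Real.cosh t ≠ 0 := fun t => by
        have := Real.cosh_pos t; positivity
      have hcont : Continuous fun t : ℝ => f (x + √(Real.sinh (2 * t)) • z)
          * ((2 * Real.pi) ^ (-(d / 2 : ℝ)) * (Real.exp (-(Real.sinh t / (2 * Real.cosh t))
          * (‖x‖ ^ 2 + ‖x + √(Real.sinh (2 * t)) • z‖ ^ 2)) * gauss (1 / 2) z)) := by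
        have h1 : Continuous fun t : ℝ => Real.sinh t / (2 * Real.cosh t) :=
          Real.continuous_sinh.div (by fun_prop) hcosh
        fun_prop
      have := hcont.tendsto 0
      simp only [mul_zero, Real.sinh_zero, Real.sqrt_zero, zero_smul, add_zero, zero_div,
        neg_zero, zero_mul, Real.exp_zero, one_mul] at this
      exact this.mono_left nhdsWithin_le_nhds
  rw [integral_const_mul, integral_const_mul, integral_gauss_half, mul_one] at hlim
  refine hlim.congr' ?_
  filter_upwards [self_mem_nhdsWithin] with t ht
  exact (intOp_mehler_eq ht f x).symm

theorem abs_intOp_mehler_le {d : ℕ} {t : ℝ} (ht : 0 < t) {f : Eucl d → ℝ} {M : ℝ}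
    (hM : ∀ x, |f x| ≤ M) (x : Eucl d) : |intOp (mehler d t) f x| ≤ M := by
  obtain ⟨C, c, hK⟩ := gaussianBound_mehler (d := d) ht
  have hM0 : 0 ≤ M := (abs_nonneg _).trans (hM 0)
  have hi : Integrable (fun y => mehler d t x y) volume := by
    simpa only [mehler_comm d t x] using hK.integrable_slice x
  calc |intOp (mehler d t) f x| ≤ ∫ y, M * mehler d t x y := by
        refine norm_integral_le_of_norm_le (f := fun y => f y • mehler d t x y) (hi.const_mul M)
          (Filter.Eventually.of_forall fun y => ?_)
        have := mehler_pos d ht x y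
        rw [norm_smul, Real.norm_of_nonneg this.le]
        gcongr
        exact hM y
    _ = M * ∫ y, mehler d t x y := integral_const_mul _ _
    _ ≤ M := mul_le_of_le_one_right hM0 (integral_mehler_le_one' ht x)

theorem memLp_intOp_mehler {d : ℕ} {t : ℝ} (ht : 0 < t) (f : L2 d) :
    MemLp (intOp (mehler d t) f) 2 volume := by
  obtain ⟨C, c, hK⟩ := gaussianBound_mehler (d := d) ht
  exact hK.memLp_intOp (Lp.memLp f)

open Classical in
/-- The heat flow of the harmonic oscillator, given by Mehler's kernel. -/
noncomputable def mehlerFlow {d : ℕ} (f : L2 d) (t : ℝ) : L2 d :=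
  if ht : 0 < t then (memLp_intOp_mehler ht f).toLp _ else f

theorem coeFn_mehlerFlow {d : ℕ} {t : ℝ} (ht : 0 < t) (f : L2 d) :
    mehlerFlow f t =ᵐ[volume] intOp (mehler d t) f := by
  rw [mehlerFlow, dif_pos ht]
  exact MemLp.coeFn_toLp _

/-- Schur's bound is applied with the image as second function: `‖u‖² ≤ (‖f‖² + ‖u‖²) / 2`. -/
theorem norm_mehlerFlow_le {d : ℕ} {t : ℝ} (ht : 0 < t) (f : L2 d) :
    ‖mehlerFlow f t‖ ≤ ‖f‖ := by
  obtain ⟨C, c, hK⟩ := gaussianBound_mehler (d := d) ht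
  have h := hK.integral_intOp_mul_le (fun x y => (mehler_pos d ht x y).le)
    (integral_mehler_le_one ht) (integral_mehler_le_one' ht) (Lp.memLp f)
    (Lp.memLp (mehlerFlow f t))
  have e : ∫ x, intOp (mehler d t) f x * mehlerFlow f t x = ‖mehlerFlow f t‖ ^ 2 := by
    rw [L2.norm_sq_eq_integral]
    refine integral_congr_ae ?_
    filter_upwards [coeFn_mehlerFlow ht f] with x hx
    rw [hx, sq]
  rw [e, ← L2.norm_sq_eq_integral, ← L2.norm_sq_eq_integral] at h
  exact le_of_sq_le_sq (by linarith) (norm_nonneg _)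

theorem intOp_congr {d : ℕ} {F : Type*} [NormedAddCommGroup F] [NormedSpace ℝ F]
    (K : Eucl d → Eucl d → F) {f g : Eucl d → ℝ} (h : f =ᵐ[volume] g) (x : Eucl d) :
    intOp K f x = intOp K g x := by
  refine integral_congr_ae ?_
  filter_upwards [h] with y hy
  rw [hy]

theorem mehlerFlow_sub {d : ℕ} {t : ℝ} (ht : 0 < t) (f g : L2 d) :
    mehlerFlow (f - g) t = mehlerFlow f t - mehlerFlow g t := by
  obtain ⟨C, c, hK⟩ := gaussianBound_mehler (d := d) ht
  refine Lp.ext ?_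
  filter_upwards [coeFn_mehlerFlow ht f, coeFn_mehlerFlow ht g, coeFn_mehlerFlow ht (f - g),
    Lp.coeFn_sub (mehlerFlow f t) (mehlerFlow g t)] with x h1 h2 h3 h4
  rw [h3, h4, Pi.sub_apply, h1, h2, intOp_congr _ (Lp.coeFn_sub f g)]
  simp only [intOp, Pi.sub_apply, sub_smul]
  exact integral_sub (hK.integrable_smul (Lp.memLp f) x) (hK.integrable_smul (Lp.memLp g) x)

/-- Contractivity gives `‖u_t - f‖² ≤ 2‖f‖² - 2⟨u_t, f⟩`, so convergence of one inner product
suffices. It follows from pointwise convergence, the compact support of `g` supplying the majorant.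
-/
theorem tendsto_mehlerFlow_of_continuous {d : ℕ} {g : Eucl d → ℝ} (hg : Continuous g)
    (hgc : HasCompactSupport g) (hg2 : MemLp g 2 volume) :
    Filter.Tendsto (mehlerFlow (hg2.toLp g)) (𝓝[>] 0) (𝓝 (hg2.toLp g)) := by
  set f := hg2.toLp g with hf
  have hfg : f =ᵐ[volume] g := hg2.coeFn_toLp
  obtain ⟨M, hM⟩ := hgc.exists_bound_of_continuous hg
  have hlim : Filter.Tendsto (fun t => ∫ x, g x * intOp (mehler d t) g x) (𝓝[>] 0)
      (𝓝 (∫ x, g x * g x)) := by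
    refine tendsto_integral_filter_of_dominated_convergence (fun x => |g x| * M) ?_ ?_ ?_ ?_
    · filter_upwards [self_mem_nhdsWithin] with t ht
      obtain ⟨C, c, hK⟩ := gaussianBound_mehler (d := d) ht
      exact hg2.1.mul (hK.memLp_intOp hg2).1
    · filter_upwards [self_mem_nhdsWithin] with t ht
      refine Filter.Eventually.of_forall fun x => ?_
      rw [norm_mul, Real.norm_eq_abs, Real.norm_eq_abs]
      gcongr
      exact abs_intOp_mehler_le ht hM x
    · exact (hg.integrable_of_hasCompactSupport hgc).abs.mul_const M
    · exact Filter.Eventually.of_forall fun x => (tendsto_intOp_mehler hg hM x).const_mul (g x)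
  have hinner : ∀ t : ℝ, 0 < t → ∫ x, g x * intOp (mehler d t) g x
      = inner ℝ (mehlerFlow f t) f := by
    intro t ht
    rw [L2.inner_eq_integral_mul]
    refine integral_congr_ae ?_
    filter_upwards [hfg, coeFn_mehlerFlow ht f] with x h1 h2
    rw [h1, h2, intOp_congr _ hfg]
  have hnorm : ∫ x, g x * g x = ‖f‖ ^ 2 := by
    rw [L2.norm_sq_eq_integral]
    refine integral_congr_ae ?_
    filter_upwards [hfg] with x h1
    rw [h1, sq]
  have hup : Filter.Tendsto (fun t => 2 * ‖f‖ ^ 2 - 2 * ∫ x, g x * intOp (mehler d t) g x)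
      (𝓝[>] 0) (𝓝 0) := by
    have := (hlim.const_mul 2).const_sub (2 * ‖f‖ ^ 2)
    rwa [hnorm, sub_self] at this
  rw [tendsto_iff_norm_sub_tendsto_zero]
  have hsq : Filter.Tendsto (fun t => ‖mehlerFlow f t - f‖ ^ 2) (𝓝[>] 0) (𝓝 0) := by
    refine tendsto_of_tendsto_of_tendsto_of_le_of_le' tendsto_const_nhds hup
      (Filter.Eventually.of_forall fun t => sq_nonneg _) ?_
    filter_upwards [self_mem_nhdsWithin] with t ht
    have h1 := norm_mehlerFlow_le ht f
    rw [hinner t ht, norm_sub_sq_real]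
    have : ‖mehlerFlow f t‖ ^ 2 ≤ ‖f‖ ^ 2 := by gcongr
    linarith
  simpa using hsq.sqrt

/-- Strong continuity of the flow at time `0`. -/
theorem tendsto_mehlerFlow {d : ℕ} (f : L2 d) :
    Filter.Tendsto (mehlerFlow f) (𝓝[>] 0) (𝓝 f) := by
  rw [Metric.tendsto_nhds]
  intro ε hε
  obtain ⟨g, hgc, hfg, hg, hg2⟩ := (Lp.memLp f).exists_hasCompactSupport_eLpNorm_sub_le
    (by simp) (ε := ENNReal.ofReal (ε / 4)) (by simpa using hε)
  set G := hg2.toLp g with hG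
  have hFG : ‖f - G‖ ≤ ε / 4 := by
    rw [Lp.norm_def]
    refine ENNReal.toReal_le_of_le_ofReal (by linarith) ?_
    refine (eLpNorm_congr_ae ?_).trans_le hfg
    filter_upwards [Lp.coeFn_sub f G, hg2.coeFn_toLp] with x h1 h2
    rw [h1, Pi.sub_apply, Pi.sub_apply, h2]
  have hev := (Metric.tendsto_nhds.1 (tendsto_mehlerFlow_of_continuous hg hgc hg2)) (ε / 4)
    (by linarith)
  filter_upwards [hev, self_mem_nhdsWithin] with t h1 ht
  have h2 := (norm_mehlerFlow_le ht (f - G)).trans hFG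
  rw [mehlerFlow_sub ht] at h2
  rw [dist_eq_norm] at h1 ⊢
  have h3 : mehlerFlow f t - f = (mehlerFlow f t - mehlerFlow G t) + (mehlerFlow G t - G)
      - (f - G) := by abel
  rw [h3]
  calc _ ≤ ‖mehlerFlow f t - mehlerFlow G t‖ + ‖mehlerFlow G t - G‖ + ‖f - G‖ :=
        (norm_sub_le _ _).trans (by gcongr; exact norm_add_le _ _)
    _ < ε := by linarith

/-! ### The Mehler flow solves the evolution equation -/

theorem memLp_intOp_mehlerDt {d : ℕ} {t : ℝ} (ht : 0 < t) (f : L2 d) :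
    MemLp (intOp (mehlerDt t) f) 2 volume := by
  obtain ⟨C, c, hK⟩ := gaussianBound_mehlerDt (d := d) ht
  exact hK.memLp_intOp (Lp.memLp f)

/-- The bound on the time derivative, uniform for times near `t`, is used twice: to differentiate
under the integral at each `x`, and as the `L²` majorant of the resulting derivatives. -/
theorem hasDerivAt_mehlerFlow {d : ℕ} {t : ℝ} (ht : 0 < t) (f : L2 d) :
    HasDerivAt (mehlerFlow f) ((memLp_intOp_mehlerDt ht f).toLp _) t := by
  obtain ⟨C, c, hC, hc, h⟩ := exists_mehler_le d ht
  have hD : ∀ s ∈ ball t (t / 2), GaussianBound (mehlerDt s : Eucl d → Eucl d → ℝ) C c :=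
    fun s hs => ⟨continuous_mehlerDt s, hc, fun x y => ((h s hs).2 x y).2⟩
  refine hasDerivAt_L2_of_dominated (φ := fun s => intOp (mehler d s) f)
    (φ' := fun s => intOp (mehlerDt s) f) (half_pos ht)
    ((memLp_gauss hc).const_mul (C * ∫ y, |f y| * gauss c y))
    (fun s hs => coeFn_mehlerFlow (h s hs).1 f) (MemLp.coeFn_toLp _) (fun x s hs => ?_)
    (fun x s hs => (hD s hs).norm_intOp_le (Lp.memLp f) x)
  have hs0 := (h s hs).1
  obtain ⟨C', c', hK⟩ := gaussianBound_mehler (d := d) hs0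
  refine (hasDerivAt_integral_of_dominated_loc_of_deriv_le (𝕜 := ℝ)
    (F := fun s y => f y • mehler d s x y) (F' := fun s y => f y • mehlerDt s x y)
    (s := ball t (t / 2)) (bound := fun y => C * gauss c x * (|f y| * gauss c y))
    (isOpen_ball.mem_nhds hs) ?_ ?_ ?_ ?_ ?_ ?_).2
  · refine Filter.Eventually.of_forall fun r => (Lp.memLp f).1.smul ?_
    exact ((continuous_mehler_fst d r).comp
      (by fun_prop : Continuous fun y : Eucl d => (x, y))).aestronglyMeasurable
  · exact hK.integrable_smul (Lp.memLp f) x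
  · exact ((hD s hs).integrable_smul (Lp.memLp f) x).1
  · exact Filter.Eventually.of_forall fun y r hr => (hD r hr).norm_smul_le f x y
  · exact (integrable_abs_mul_gauss (Lp.memLp f) hc).const_mul _
  · exact Filter.Eventually.of_forall fun y r hr =>
      (hasDerivAt_mehler d (h r hr).1 x y).const_mul (f y)

theorem intOp_norm_sq_mul {d : ℕ} (K : Eucl d → Eucl d → ℝ) (f : Eucl d → ℝ) (x : Eucl d) :
    intOp (fun x y => ‖x‖ ^ 2 * K x y) f x = ‖x‖ ^ 2 * intOp K f x := by
  simp only [intOp, smul_eq_mul, mul_left_comm _ (‖x‖ ^ 2)]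
  exact integral_const_mul _ _

theorem inFormDomain_mehlerFlow {d : ℕ} {t : ℝ} (ht : 0 < t) (f : L2 d) :
    InFormDomain (harmonicPotential d) (mehlerFlow f t) (intOp (mehlerGrad t) f) := by
  obtain ⟨C₀, c₀, hK⟩ := gaussianBound_mehler (d := d) ht
  obtain ⟨C₁, c₁, hG⟩ := gaussianBound_mehlerGrad (d := d) ht
  obtain ⟨C₃, c₃, hQ⟩ := gaussianBound_norm_sq_mul_mehler (d := d) ht
  have hu := coeFn_mehlerFlow ht f
  refine ⟨Lp.memLp _, hG.memLp_intOp (Lp.memLp f), ?_, ?_⟩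
  · intro φ hφ hφc e
    have hφ' : Continuous fun x => fderiv ℝ φ x e :=
      (hφ.continuous_fderiv (by simp)).clm_apply continuous_const
    have hφ2 : MemLp (fun x => fderiv ℝ φ x e) 2 volume := by
      refine hφ'.memLp_of_hasCompactSupport ?_
      exact (hφc.fderiv (𝕜 := ℝ)).comp_left (g := fun L : Eucl d →L[ℝ] ℝ => L e) (by simp)
    have hφe : MemLp (fun x => φ x • e) 2 volume := by
      refine Continuous.memLp_of_hasCompactSupport (hφ.continuous.smul continuous_const) ?_
      exact hφc.comp_left (g := fun r : ℝ => r • e) (by simp)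
    calc ∫ x, mehlerFlow f t x * fderiv ℝ φ x e
        = ∫ x, intOp (mehler d t) f x * fderiv ℝ φ x e := by
          refine integral_congr_ae ?_
          filter_upwards [hu] with x hx
          rw [hx]
      _ = ∫ y, f y * ∫ x, mehler d t x y * fderiv ℝ φ x e :=
          hK.integral_intOp_mul (Lp.memLp f) hφ2
      _ = ∫ y, -(f y * ∫ x, (inner ℝ (mehlerGrad t x y) (φ x • e) : ℝ)) := by
          refine integral_congr_ae (Filter.Eventually.of_forall fun y => ?_)
          simp only [integral_mehler_mul_fderiv ht y hφ hφc e, real_inner_smul_right]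
          simp only [mul_comm (φ _), mul_neg]
      _ = - ∫ x, (inner ℝ (intOp (mehlerGrad t) f x) (φ x • e) : ℝ) := by
          rw [integral_neg, hG.integral_inner_intOp (Lp.memLp f) hφe]
      _ = _ := by simp only [real_inner_smul_right]
  · have h1 : Integrable (fun x => intOp (fun x y => ‖x‖ ^ 2 * mehler d t x y) f x
        * mehlerFlow f t x) volume := (hQ.memLp_intOp (Lp.memLp f)).integrable_mul (Lp.memLp _)
    refine h1.congr ?_
    filter_upwards [hu] with x hx
    rw [intOp_norm_sq_mul, hx, harmonicPotential]
    ring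

/-- The equation for each slice, `integral_inner_mehlerGrad`, is integrated against `f y`. -/
theorem schrodingerOp_mehlerFlow {d : ℕ} {t : ℝ} (ht : 0 < t) (f : L2 d) :
    SchrodingerOp (harmonicPotential d) (mehlerFlow f t)
      (-(memLp_intOp_mehlerDt ht f).toLp _) := by
  obtain ⟨C₁, c₁, hG⟩ := gaussianBound_mehlerGrad (d := d) ht
  obtain ⟨C₂, c₂, hD⟩ := gaussianBound_mehlerDt (d := d) ht
  obtain ⟨C₃, c₃, hQ⟩ := gaussianBound_norm_sq_mul_mehler (d := d) ht
  have hu := coeFn_mehlerFlow ht f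
  refine ⟨_, inFormDomain_mehlerFlow ht f, fun v H hv => ?_⟩
  have e1 : ∫ x, harmonicPotential d x * mehlerFlow f t x * v x
      = ∫ x, intOp (fun x y => ‖x‖ ^ 2 * mehler d t x y) f x * v x := by
    refine integral_congr_ae ?_
    filter_upwards [hu] with x hx
    rw [intOp_norm_sq_mul, hx, harmonicPotential]
  have e2 : ∫ x, (-(memLp_intOp_mehlerDt ht f).toLp _ : L2 d) x * v x
      = - ∫ x, intOp (mehlerDt t) f x * v x := by
    rw [← integral_neg]
    refine integral_congr_ae ?_
    filter_upwards [Lp.coeFn_neg ((memLp_intOp_mehlerDt ht f).toLp _),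
      (memLp_intOp_mehlerDt ht f).coeFn_toLp] with x h1 h2
    rw [h1, Pi.neg_apply, h2, neg_mul]
  rw [e1, e2, hG.integral_inner_intOp (Lp.memLp f) hv.memLp_grad,
    hQ.integral_intOp_mul (Lp.memLp f) hv.memLp, hD.integral_intOp_mul (Lp.memLp f) hv.memLp,
    ← integral_neg, ← integral_add]
  · refine integral_congr_ae (Filter.Eventually.of_forall fun y => ?_)
    simp only
    rw [← mul_add, integral_inner_mehlerGrad ht y hv.weakGradient hv.memLp hv.memLp_grad, mul_neg]
  · have := (hG.integrable_inner_prod (Lp.memLp f) hv.memLp_grad).integral_prod_right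
    simpa only [real_inner_smul_left, integral_const_mul] using this
  · have := (hQ.integrable_inner_prod (Lp.memLp f) hv.memLp).integral_prod_right
    simp only [real_inner_smul_left, integral_const_mul] at this
    simpa [mul_comm] using this

/-- Mehler's kernel is the heat kernel of the harmonic oscillator. -/
theorem isHeatKernel_mehler (d : ℕ) : IsHeatKernel (harmonicPotential d) (mehler d) := by
  refine ⟨continuousOn_mehler d, fun f => ⟨mehlerFlow f, ⟨?_, ?_, ?_⟩, ?_⟩⟩
  · simp [mehlerFlow]
  · intro t ht
    rcases (mem_Ici.1 ht).eq_or_lt with rfl | ht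
    · have h0 : mehlerFlow f 0 = f := by simp [mehlerFlow]
      rw [← continuousWithinAt_Ioi_iff_Ici, ContinuousWithinAt, h0]
      exact tendsto_mehlerFlow f
    · exact (hasDerivAt_mehlerFlow ht f).continuousAt.continuousWithinAt
  · intro t ht
    refine ⟨_, schrodingerOp_mehlerFlow ht f, ?_⟩
    rw [neg_neg]
    exact hasDerivAt_mehlerFlow ht f
  · intro t ht
    obtain ⟨C, c, hK⟩ := gaussianBound_mehler (d := d) ht
    filter_upwards [coeFn_mehlerFlow ht f] with x hx
    refine ⟨?_, ?_⟩
    · have := hK.integrable_smul (Lp.memLp f) x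
      simpa only [smul_eq_mul, mul_comm] using this
    · rw [hx]
      simp only [intOp, smul_eq_mul, mul_comm]

theorem heatKernel_harmonicPotential (d : ℕ) {t : ℝ} (ht : 0 < t) (x y : Eucl d) :
    heatKernel (harmonicPotential d) t x y = mehler d t x y := by
  refine (isHeatKernel_mehler d).heatKernel_eq (fun x => sq_nonneg ‖x‖) ?_ ht x y
  exact (continuous_norm.pow 2).measurable

/-! ### The critical radius of the harmonic potential -/

theorem integrableOn_harmonicPotential {d : ℕ} (x : Eucl d) (r : ℝ) :
    IntegrableOn (harmonicPotential d) (ball x r) volume :=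
  ((continuous_norm.pow 2).locallyIntegrable.integrableOn_isCompact
    (isCompact_closedBall x r)).mono_set ball_subset_closedBall

theorem volume_real_ball {d : ℕ} (x : Eucl d) {r : ℝ} (hr : 0 < r) :
    volume.real (ball x r) = r ^ d * volume.real (ball (0 : Eucl d) 1) := by
  rw [measureReal_def, Measure.addHaar_ball_of_pos _ x hr, finrank_euclideanSpace_fin,
    ENNReal.toReal_mul, ENNReal.toReal_ofReal (by positivity), measureReal_def]

theorem volume_real_unitBall_pos (d : ℕ) : 0 < volume.real (ball (0 : Eucl d) 1) :=
  ENNReal.toReal_pos (measure_ball_pos volume _ one_pos).ne' measure_ball_lt_top.ne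

theorem exists_norm_add_eq {d : ℕ} (hd : 0 < d) (x : Eucl d) {s : ℝ} (hs : 0 ≤ s) :
    ∃ z : Eucl d, ‖z‖ = s ∧ ‖x + z‖ = ‖x‖ + s := by
  have : Nonempty (Fin d) := ⟨⟨0, hd⟩⟩
  by_cases hx : x = 0
  · obtain ⟨z, hz⟩ := NormedSpace.exists_lt_norm ℝ (Eucl d) 0
    refine ⟨(s / ‖z‖) • z, ?_, ?_⟩
    · rw [norm_smul, Real.norm_of_nonneg (by positivity)]
      field_simp
    · rw [hx, zero_add, norm_zero, zero_add, norm_smul, Real.norm_of_nonneg (by positivity)]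
      field_simp
  · have hx0 : 0 < ‖x‖ := norm_pos_iff.2 hx
    refine ⟨(s / ‖x‖) • x, ?_, ?_⟩
    · rw [norm_smul, Real.norm_of_nonneg (by positivity)]
      field_simp
    · have : x + (s / ‖x‖) • x = (1 + s / ‖x‖) • x := by rw [add_smul, one_smul]
      rw [this, norm_smul, Real.norm_of_nonneg (by positivity)]
      field_simp

theorem zpow_sub_two_mul_sq {d : ℕ} {r : ℝ} (hr : 0 < r) : 1 / r ^ ((d : ℤ) - 2) * r ^ d = r ^ 2 := by
  rw [zpow_sub₀ hr.ne', zpow_natCast]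
  field_simp

/-- The ball of radius `r/4` centred at distance `r/2` from `x`, radially outward, lies in `B(x,r)`,
and `|y| ≥ |x| + r/4` on it. An admissible `r` thus satisfies `r² (|x| + r/4)² ≤ A`, which controls
both `r|x|` and `r`. -/
theorem exists_criticalRadius_le {d : ℕ} (hd : 0 < d) : ∃ K : ℝ, 1 ≤ K ∧ ∀ (x : Eucl d) (r : ℝ),
    0 < r → 1 / r ^ ((d : ℤ) - 2) * ∫ y in ball x r, harmonicPotential d y ≤ 1 →
      r * (1 + ‖x‖) ≤ K := by
  set b := volume.real (ball (0 : Eucl d) 1) with hb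
  have hb0 : 0 < b := volume_real_unitBall_pos d
  set A := 4 ^ d / b with hA
  have hA0 : 0 < A := by positivity
  refine ⟨2 * A + 3, by linarith, fun x r hr h => ?_⟩
  obtain ⟨z, hz, hxz⟩ := exists_norm_add_eq hd x (s := r / 2) (by positivity)
  have hsub : ball (x + z) (r / 4) ⊆ ball x r := by
    refine ball_subset_ball' ?_
    rw [dist_eq_norm, add_sub_cancel_left, hz]
    linarith
  have h1 : (‖x‖ + r / 4) ^ 2 * ((r / 4) ^ d * b) ≤ ∫ y in ball x r, harmonicPotential d y := by
    calc (‖x‖ + r / 4) ^ 2 * ((r / 4) ^ d * b)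
        = ∫ y in ball (x + z) (r / 4), (‖x‖ + r / 4) ^ 2 := by
          rw [setIntegral_const, volume_real_ball _ (by positivity), smul_eq_mul, mul_comm]
      _ ≤ ∫ y in ball (x + z) (r / 4), harmonicPotential d y := by
          refine setIntegral_mono_on (integrableOn_const measure_ball_lt_top.ne)
            (integrableOn_harmonicPotential _ _) measurableSet_ball fun y hy => ?_
          rw [mem_ball, dist_eq_norm] at hy
          have h3 : ‖x + z‖ ≤ ‖y‖ + ‖y - (x + z)‖ := by
            have := norm_sub_le y (y - (x + z))
            rwa [sub_sub_cancel] at this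
          have h2 : ‖x‖ + r / 4 ≤ ‖y‖ := by linarith
          rw [harmonicPotential]
          gcongr
      _ ≤ ∫ y in ball x r, harmonicPotential d y :=
          setIntegral_mono_set (integrableOn_harmonicPotential _ _)
            (Filter.Eventually.of_forall fun y => sq_nonneg ‖y‖) hsub.eventuallyLE
  have h2 : r ^ 2 * (‖x‖ + r / 4) ^ 2 ≤ A := by
    have h3 : 1 / r ^ ((d : ℤ) - 2) * ((‖x‖ + r / 4) ^ 2 * ((r / 4) ^ d * b)) ≤ 1 :=
      (by gcongr : _ ≤ _).trans h
    have h4 : 1 / r ^ ((d : ℤ) - 2) * ((‖x‖ + r / 4) ^ 2 * ((r / 4) ^ d * b))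
        = r ^ 2 * (‖x‖ + r / 4) ^ 2 / A := by
      rw [← zpow_sub_two_mul_sq (d := d) hr, hA, div_pow]
      field_simp
    rw [h4, div_le_one hA0] at h3
    exact h3
  have h5 : r * (‖x‖ + r / 4) ≤ A + 1 := by
    have : (r * (‖x‖ + r / 4)) ^ 2 ≤ A := by rw [mul_pow]; exact h2
    nlinarith [sq_nonneg (r * (‖x‖ + r / 4) - 1 / 2)]
  have h6 : 0 ≤ r * ‖x‖ := by positivity
  -- Uses `r ≤ r²/4 + 1`.
  nlinarith [sq_nonneg (r / 2 - 1)]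

theorem exists_mem_criticalRadius {d : ℕ} (x : Eucl d) : ∃ r : ℝ, 0 < r ∧
    1 / r ^ ((d : ℤ) - 2) * ∫ y in ball x r, harmonicPotential d y ≤ 1 := by
  set b := volume.real (ball (0 : Eucl d) 1) with hb
  have hb0 : 0 < b := volume_real_unitBall_pos d
  -- Chosen at most `1`, so that `|y| ≤ |x| + 1` on the ball, and so that the normalised integral is
  -- at most `b / (b + 1)²`.
  set r := 1 / ((‖x‖ + 1) * (b + 1)) with hr
  have hr0 : 0 < r := by positivity
  have hr1 : r ≤ 1 := by
    rw [hr, div_le_one (by positivity)]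
    nlinarith [mul_nonneg (norm_nonneg x) hb0.le, norm_nonneg x]
  refine ⟨r, hr0, ?_⟩
  have h1 : ∫ y in ball x r, harmonicPotential d y ≤ (‖x‖ + 1) ^ 2 * (r ^ d * b) := by
    calc ∫ y in ball x r, harmonicPotential d y ≤ ∫ y in ball x r, (‖x‖ + 1) ^ 2 := by
          refine setIntegral_mono_on (integrableOn_harmonicPotential _ _)
            (integrableOn_const measure_ball_lt_top.ne) measurableSet_ball fun y hy => ?_
          rw [mem_ball, dist_eq_norm] at hy
          have h3 : ‖y‖ ≤ ‖x‖ + ‖y - x‖ := by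
            have := norm_add_le x (y - x)
            rwa [add_sub_cancel] at this
          rw [harmonicPotential]
          gcongr
          linarith
      _ = _ := by rw [setIntegral_const, volume_real_ball _ hr0, smul_eq_mul, mul_comm]
  calc _ ≤ 1 / r ^ ((d : ℤ) - 2) * ((‖x‖ + 1) ^ 2 * (r ^ d * b)) := by gcongr
    _ = (1 / r ^ ((d : ℤ) - 2) * r ^ d) * ((‖x‖ + 1) ^ 2 * b) := by ring
    _ = r ^ 2 * ((‖x‖ + 1) ^ 2 * b) := by rw [zpow_sub_two_mul_sq hr0]
    _ = b / (b + 1) ^ 2 := by rw [hr]; field_simp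
    _ ≤ 1 := by
      rw [div_le_one (by positivity)]
      nlinarith [sq_nonneg b]

theorem exists_le_div_criticalRadius {d : ℕ} (hd : 0 < d) : ∃ K : ℝ, 1 ≤ K ∧
    ∀ (x : Eucl d) (r : ℝ), 0 < r →
      r * (1 + ‖x‖) / K ≤ r / criticalRadius (harmonicPotential d) x := by
  obtain ⟨K, hK1, hK⟩ := exists_criticalRadius_le hd
  refine ⟨K, hK1, fun x r hr => ?_⟩
  obtain ⟨s, hs, hs'⟩ := exists_mem_criticalRadius x
  have hub : ∀ a ∈ {r : ℝ | 0 < r ∧ 1 / r ^ ((d : ℤ) - 2)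
      * ∫ y in ball x r, harmonicPotential d y ≤ 1}, a ≤ K / (1 + ‖x‖) := by
    rintro a ⟨ha, ha'⟩
    rw [le_div_iff₀ (by positivity)]
    exact hK x a ha ha'
  -- Positivity matters: the real `sSup` is `0` on an empty or unbounded set, and `r / 0 = 0` would
  -- violate the bound.
  have h1 : 0 < criticalRadius (harmonicPotential d) x :=
    hs.trans_le (le_csSup ⟨_, hub⟩ ⟨hs, hs'⟩)
  have h2 : criticalRadius (harmonicPotential d) x ≤ K / (1 + ‖x‖) := csSup_le ⟨s, hs, hs'⟩ hub
  calc r * (1 + ‖x‖) / K = r / (K / (1 + ‖x‖)) := by field_simp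
    _ ≤ _ := by gcongr

/-! ### Lower bound for Mehler's kernel on a ball -/

theorem sinh_le_mul_exp (t : ℝ) : Real.sinh t ≤ t * Real.exp t := by
  have h1 := Real.add_one_le_exp (-(2 * t))
  have h2 : Real.exp (-t) = Real.exp (-(2 * t)) * Real.exp t := by
    rw [← Real.exp_add]; ring_nf
  rw [Real.sinh_eq, h2]
  nlinarith [Real.exp_pos t]

theorem cosh_sub_one_div_sinh_le {t : ℝ} (ht : 0 < t) :
    (Real.cosh (2 * t) - 1) / (2 * Real.sinh (2 * t)) ≤ t := by
  have h1 := Real.cosh_pos t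
  rw [cosh_sub_one_div_sinh ht, div_le_iff₀ (by positivity)]
  refine (sinh_le_mul_exp t).trans ?_
  have : Real.exp t ≤ 2 * Real.cosh t := by
    rw [Real.cosh_eq]
    linarith [Real.exp_pos (-t)]
  gcongr

/-- Lower bound for Mehler's kernel on a ball of radius `r`, at time `min 1 r²`. -/
theorem le_mehler_of_mem_ball {d : ℕ} {x₀ : Eucl d} {r : ℝ} (hr : 0 < r) {x y : Eucl d}
    (hx : x ∈ ball x₀ r) (hy : y ∈ ball x₀ r) :
    (4 * Real.pi * Real.exp 2) ^ (-(d / 2 : ℝ)) * (r ^ d)⁻¹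
        * Real.exp (-3 * (1 + r * (1 + ‖x₀‖)) ^ 2)
      ≤ mehler d (min 1 (r ^ 2)) x y := by
  -- Parabolic scaling for small balls. The cap at `1` keeps `sinh 2t` comparable to `t` and keeps
  -- the confining term `t (|x₀| + r)²` within `E²` for large balls, at the price `r²/t = r² ≤ E²`.
  set t := min 1 (r ^ 2) with ht
  have ht0 : 0 < t := lt_min one_pos (by positivity)
  have ht1 : t ≤ 1 := min_le_left _ _
  have htr : t ≤ r ^ 2 := min_le_right _ _
  have hS := sinh_two_mul_pos ht0
  rw [mem_ball, dist_eq_norm] at hx hy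
  have hx0 := norm_nonneg x₀
  have hxn : ‖x‖ ≤ ‖x₀‖ + r := by
    have := norm_add_le x₀ (x - x₀)
    rw [add_sub_cancel] at this
    linarith
  have hyn : ‖y‖ ≤ ‖x₀‖ + r := by
    have := norm_add_le x₀ (y - x₀)
    rw [add_sub_cancel] at this
    linarith
  have hxy : ‖x - y‖ ≤ 2 * r := by
    have := norm_sub_le (x - x₀) (y - x₀)
    rw [sub_sub_sub_cancel_right] at this
    linarith
  have hS1 : Real.sinh (2 * t) ≤ 2 * Real.exp 2 * r ^ 2 := by
    calc Real.sinh (2 * t) ≤ 2 * t * Real.exp (2 * t) := sinh_le_mul_exp _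
      _ ≤ 2 * r ^ 2 * Real.exp 2 := by gcongr; linarith
      _ = _ := by ring
  have hS2 : 2 * t ≤ Real.sinh (2 * t) := Real.self_le_sinh_iff.2 (by linarith)
  set E := 1 + r * (1 + ‖x₀‖) with hE
  have ha : t * (‖x₀‖ + r) ^ 2 ≤ E ^ 2 := by
    rcases le_total r 1 with h | h
    · calc t * (‖x₀‖ + r) ^ 2 ≤ r ^ 2 * (‖x₀‖ + 1) ^ 2 := by gcongr
        _ = (r * (1 + ‖x₀‖)) ^ 2 := by ring
        _ ≤ E ^ 2 := by gcongr; linarith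
    · calc t * (‖x₀‖ + r) ^ 2 ≤ 1 * (r * ‖x₀‖ + r) ^ 2 := by
            gcongr
            exact le_mul_of_one_le_left hx0 h
        _ = (r * (1 + ‖x₀‖)) ^ 2 := by ring
        _ ≤ E ^ 2 := by gcongr; linarith
  have hb : r ^ 2 / t ≤ E ^ 2 := by
    have hrx : 0 ≤ r * ‖x₀‖ := by positivity
    rcases le_total r 1 with h | h
    · have : t = r ^ 2 := min_eq_right (by nlinarith)
      rw [this, div_self (by positivity)]
      nlinarith
    · have : t = 1 := min_eq_left (by nlinarith)
      rw [this, div_one]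
      gcongr
      linarith
  -- The confining term costs `2E²` and the diffusive term `E²`.
  have harg : -3 * E ^ 2 ≤ mehlerArg t x y := by
    rw [mehlerArg_eq ht0]
    have h1 : (Real.cosh (2 * t) - 1) / (2 * Real.sinh (2 * t)) * (‖x‖ ^ 2 + ‖y‖ ^ 2)
        ≤ 2 * E ^ 2 := by
      calc _ ≤ t * ((‖x₀‖ + r) ^ 2 + (‖x₀‖ + r) ^ 2) := by
            gcongr
            exact cosh_sub_one_div_sinh_le ht0
        _ ≤ _ := by linarith
    have h2 : ‖x - y‖ ^ 2 / (2 * Real.sinh (2 * t)) ≤ E ^ 2 := by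
      calc _ ≤ (2 * r) ^ 2 / (2 * (2 * t)) := by gcongr
        _ = r ^ 2 / t := by field_simp
        _ ≤ _ := hb
    linarith
  have hnorm : (4 * Real.pi * Real.exp 2) ^ (-(d / 2 : ℝ)) * (r ^ d)⁻¹ ≤ mehlerNorm d t := by
    have h1 : (r ^ d)⁻¹ = (r ^ 2) ^ (-(d / 2 : ℝ)) := by
      rw [← Real.rpow_natCast, ← Real.rpow_natCast, ← Real.rpow_mul hr.le, ← Real.rpow_neg hr.le]
      congr 1
      push_cast
      ring
    rw [h1, ← Real.mul_rpow (by positivity) (by positivity), mehlerNorm]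
    refine Real.rpow_le_rpow_of_nonpos (by positivity) ?_ (neg_nonpos.2 (by positivity))
    calc 2 * Real.pi * Real.sinh (2 * t) ≤ 2 * Real.pi * (2 * Real.exp 2 * r ^ 2) := by gcongr
      _ = _ := by ring
  have hN := (mehlerNorm_pos d ht0).le
  rw [mehler]
  gcongr

/-! ### Testing the maximal operator on the dual weight -/

theorem IsWeight.aemeasurable_ofReal {d : ℕ} {w : Eucl d → ℝ} (hw : IsWeight w) :
    AEMeasurable (fun y => ENNReal.ofReal (w y)) volume :=
  hw.locallyIntegrable.aestronglyMeasurable.aemeasurable.ennreal_ofReal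

/-- If the heat kernel is bounded below by `κ` on a ball at some time, then boundedness of the
maximal operator tested on a function bounded above by the dual weight gives a bound. -/
theorem mul_rpow_le_of_heatMaximal_le {d : ℕ} {V w : Eucl d → ℝ} {p : ℝ} (hp : 1 < p)
    (hw : IsWeight w) {C : ℝ≥0}
    (hC : ∀ f : Eucl d → ℝ, LocallyIntegrable f volume →
      MemLp f (ENNReal.ofReal p) (weightMeasure w) →
        eLpNorm (heatMaximal V f) (ENNReal.ofReal p) (weightMeasure w)
          ≤ C * eLpNorm f (ENNReal.ofReal p) (weightMeasure w))
    {x₀ : Eucl d} {r t κ : ℝ} (ht : 0 < t)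
    (hκ : ∀ x ∈ ball x₀ r, ∀ y ∈ ball x₀ r, κ ≤ heatKernel V t x y)
    {φ : Eucl d → ℝ≥0∞} (hφm : AEMeasurable φ volume) {n : ℕ} (hφn : ∀ y, φ y ≤ n)
    (hφ : ∀ y, φ y ≤ ENNReal.ofReal (w y) ^ (-(1 / (p - 1)))) :
    ENNReal.ofReal κ * (∫⁻ y in ball x₀ r, ENNReal.ofReal (w y)) ^ (1 / p)
      * (∫⁻ y in ball x₀ r, φ y) ^ ((p - 1) / p) ≤ C := by
  have hp0 : 0 < p := by linarith
  have hp1 : 0 < p - 1 := by linarith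
  set B := ball x₀ r with hB
  have hBm : MeasurableSet B := measurableSet_ball
  set F := ∫⁻ y in B, φ y with hF
  set W := ∫⁻ y in B, ENNReal.ofReal (w y) with hW
  -- Boundedness of `φ` enters here: finiteness of `F` makes the test function admissible and later
  -- permits cancelling `F ^ (1 / p)`.
  have hFtop : F ≠ ⊤ := by
    refine ((setLIntegral_mono measurable_const fun y _ => hφn y).trans_lt ?_).ne
    rw [setLIntegral_const]
    exact ENNReal.mul_lt_top (ENNReal.natCast_lt_top n) measure_ball_lt_top
  set f : Eucl d → ℝ := fun y => (B.indicator φ y).toReal with hf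
  have hfe : ∀ y, ‖f y‖ₑ = B.indicator φ y := by
    intro y
    rw [hf, Real.enorm_of_nonneg ENNReal.toReal_nonneg, ENNReal.ofReal_toReal]
    by_cases hy : y ∈ B
    · rw [indicator_of_mem hy]
      exact ((hφn y).trans_lt (ENNReal.natCast_lt_top n)).ne
    · rw [indicator_of_notMem hy]
      exact ENNReal.zero_ne_top
  have hfm : AEStronglyMeasurable f volume := (hφm.indicator hBm).ennreal_toReal.aestronglyMeasurable
  have hfF : ∫⁻ y, ‖f y‖ₑ = F := by
    simp only [hfe]
    rw [lintegral_indicator hBm]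
  have hfint : Integrable f volume := ⟨hfm, by
    rw [HasFiniteIntegral, hfF]; exact hFtop.lt_top⟩
  have hpne : ENNReal.ofReal p ≠ 0 := by simpa using hp0
  have hpt : (ENNReal.ofReal p).toReal = p := ENNReal.toReal_ofReal hp0.le
  have hnormf : eLpNorm f (ENNReal.ofReal p) (weightMeasure w) ≤ F ^ (1 / p) := by
    rw [eLpNorm_eq_lintegral_rpow_enorm_toReal hpne ENNReal.ofReal_ne_top, hpt]
    refine ENNReal.rpow_le_rpow ?_ (by positivity)
    rw [weightMeasure, lintegral_withDensity_eq_lintegral_mul₀ hw.aemeasurable_ofReal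
      (hfm.enorm.pow_const p), ← hfF]
    refine lintegral_mono_ae ?_
    filter_upwards [hw.ae_pos] with y hy
    rw [Pi.mul_apply, hfe]
    by_cases hyB : y ∈ B
    · rw [indicator_of_mem hyB]
      set a := ENNReal.ofReal (w y) with ha
      have ha0 : a ≠ 0 := by simpa [ha] using hy
      have hat : a ≠ ⊤ := ENNReal.ofReal_ne_top
      -- Since `φ ≤ w^{-1/(p-1)}`, we have `w φ^{p-1} ≤ 1`; hence the `p`-th power of the weighted
      -- norm of `f` is at most `F`.
      calc a * φ y ^ p = φ y ^ (p - 1) * φ y * a := by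
            rw [mul_comm a]
            congr 1
            rw [show φ y ^ (p - 1) * φ y = φ y ^ (p - 1) * φ y ^ (1 : ℝ) by rw [ENNReal.rpow_one],
              ← ENNReal.rpow_add_of_nonneg _ _ hp1.le zero_le_one, sub_add_cancel]
        _ ≤ (a ^ (-(1 / (p - 1)))) ^ (p - 1) * φ y * a := by
            gcongr
            exact hφ y
        _ = φ y := by
            rw [← ENNReal.rpow_mul, show -(1 / (p - 1)) * (p - 1) = -1 by field_simp,
              ENNReal.rpow_neg_one, mul_right_comm, ENNReal.inv_mul_cancel ha0 hat, one_mul]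
    · rw [indicator_of_notMem hyB, ENNReal.zero_rpow_of_pos hp0, mul_zero]
  have hmem : MemLp f (ENNReal.ofReal p) (weightMeasure w) :=
    ⟨hfm.mono_ac (withDensity_absolutelyContinuous _ _),
      hnormf.trans_lt (ENNReal.rpow_lt_top_of_nonneg (by positivity) hFtop)⟩
  have hT : ∀ x ∈ B, ENNReal.ofReal κ * F ≤ heatMaximal V f x := by
    intro x hx
    refine le_trans ?_ (le_iSup₂ (f := fun (t : ℝ) (_ : 0 < t) =>
      ∫⁻ y, ENNReal.ofReal (heatKernel V t x y) * ‖f y‖ₑ) t ht)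
    rw [← hfF]
    refine (lintegral_const_mul_le _ _).trans (lintegral_mono fun y => ?_)
    by_cases hyB : y ∈ B
    · gcongr
      exact hκ x hx y hyB
    · rw [hfe, indicator_of_notMem hyB, mul_zero, mul_zero]
  have hlow : ENNReal.ofReal κ * F * W ^ (1 / p)
      ≤ eLpNorm (heatMaximal V f) (ENNReal.ofReal p) (weightMeasure w) := by
    rw [eLpNorm_eq_lintegral_rpow_enorm_toReal hpne ENNReal.ofReal_ne_top, hpt]
    have hWB : W = weightMeasure w B := by rw [weightMeasure, withDensity_apply _ hBm]
    calc ENNReal.ofReal κ * F * W ^ (1 / p)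
        = ((ENNReal.ofReal κ * F) ^ p * weightMeasure w B) ^ (1 / p) := by
          rw [ENNReal.mul_rpow_of_nonneg _ _ (by positivity), ← ENNReal.rpow_mul, hWB,
            mul_one_div_cancel hp0.ne', ENNReal.rpow_one]
      _ ≤ (∫⁻ x, ‖heatMaximal V f x‖ₑ ^ p ∂weightMeasure w) ^ (1 / p) := by
          refine ENNReal.rpow_le_rpow ?_ (by positivity)
          rw [← setLIntegral_const]
          refine (setLIntegral_mono' hBm fun x hx => ?_).trans (setLIntegral_le_lintegral B _)
          exact ENNReal.rpow_le_rpow (hT x hx) hp0.le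
  have hmain : ENNReal.ofReal κ * F * W ^ (1 / p) ≤ C * F ^ (1 / p) :=
    hlow.trans ((hC f hfint.locallyIntegrable hmem).trans (by gcongr))
  rcases eq_or_ne F 0 with hF0 | hF0
  · rw [hF0, ENNReal.zero_rpow_of_pos (by positivity), mul_zero]
    exact zero_le
  have hsplit : F = F ^ ((p - 1) / p) * F ^ (1 / p) := by
    rw [← ENNReal.rpow_add _ _ hF0 hFtop, ← add_div, sub_add_cancel, div_self hp0.ne',
      ENNReal.rpow_one]
  have hFp0 : F ^ (1 / p) ≠ 0 := (ENNReal.rpow_pos (pos_iff_ne_zero.2 hF0) hFtop).ne'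
  have hFpt : F ^ (1 / p) ≠ ⊤ := ENNReal.rpow_ne_top_of_nonneg (by positivity) hFtop
  refine (ENNReal.mul_le_mul_iff_left hFp0 hFpt).1 ?_
  calc _ = ENNReal.ofReal κ * (F ^ ((p - 1) / p) * F ^ (1 / p)) * W ^ (1 / p) := by ring
    _ ≤ _ := by rw [← hsplit]; exact hmain

/-- The dual weight is not known to be locally integrable. Its truncations at height `n` are
admissible with the same constant `C`, and monotone convergence removes the truncation; finiteness
of the dual integral is never presupposed. -/
theorem mul_rpow_dual_le_of_heatMaximal_le {d : ℕ} {V w : Eucl d → ℝ} {p : ℝ} (hp : 1 < p)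
    (hw : IsWeight w) {C : ℝ≥0}
    (hC : ∀ f : Eucl d → ℝ, LocallyIntegrable f volume →
      MemLp f (ENNReal.ofReal p) (weightMeasure w) →
        eLpNorm (heatMaximal V f) (ENNReal.ofReal p) (weightMeasure w)
          ≤ C * eLpNorm f (ENNReal.ofReal p) (weightMeasure w))
    {x₀ : Eucl d} {r t κ : ℝ} (ht : 0 < t)
    (hκ : ∀ x ∈ ball x₀ r, ∀ y ∈ ball x₀ r, κ ≤ heatKernel V t x y) :
    ENNReal.ofReal κ * (∫⁻ y in ball x₀ r, ENNReal.ofReal (w y)) ^ (1 / p)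
      * (∫⁻ y in ball x₀ r, ENNReal.ofReal (w y) ^ (-(1 / (p - 1)))) ^ ((p - 1) / p) ≤ C := by
  have hp0 : 0 < p := by linarith
  have ha : 0 < (p - 1) / p := div_pos (by linarith) hp0
  set φ : ℕ → Eucl d → ℝ≥0∞ := fun n y => min (ENNReal.ofReal (w y) ^ (-(1 / (p - 1)))) n with hφ
  have hφm : ∀ n, AEMeasurable (φ n) volume := fun n =>
    (hw.aemeasurable_ofReal.pow_const _).min aemeasurable_const
  have hsup : ∫⁻ y in ball x₀ r, ENNReal.ofReal (w y) ^ (-(1 / (p - 1)))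
      = ⨆ n, ∫⁻ y in ball x₀ r, φ n y := by
    rw [← lintegral_iSup' (fun n => (hφm n).restrict)
      (Filter.Eventually.of_forall fun y m n hmn => by simp only [hφ]; gcongr)]
    refine lintegral_congr fun y => ?_
    simp only [hφ]
    rw [← inf_iSup_eq, ENNReal.iSup_natCast, inf_top_eq]
  rw [hsup, (ENNReal.monotone_rpow_of_nonneg ha.le).map_iSup_of_continuousAt
    ENNReal.continuous_rpow_const.continuousAt (by simpa using ha), ENNReal.mul_iSup]
  exact iSup_le fun n => mul_rpow_le_of_heatMaximal_le hp hw hC ht hκ (hφm n)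
    (fun y => min_le_right _ _) (fun y => min_le_left _ _)

/-! ### Conclusion -/

theorem mainTheorem12 (d : ℕ) (hd : 3 ≤ d) :
    ∃ c m : ℝ, 0 < c ∧ 0 < m ∧
      ∀ (p : ℝ), 1 < p → ∀ (w : Eucl d → ℝ), IsWeight w →
        HeatMaximalBounded (harmonicPotential d) p w →
          w ∈ HeatWeightClass (harmonicPotential d) m p c := by
  obtain ⟨K, hK1, hK⟩ := exists_le_div_criticalRadius (d := d) (by omega)
  have hK0 : 0 < K := by linarith
  -- The kernel bound loses `exp(3E²)` and `E ≤ K (1 + r/ρ)`, whence `c = 3K²` and `m = 2`. The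
  -- inequality `K ≥ 1` absorbs the summand `1` of `E`.
  refine ⟨3 * K ^ 2, 2, by positivity, two_pos, fun p hp w hw ⟨C, hC⟩ => ⟨hw, ?_⟩⟩
  have hp0 : 0 < p := by linarith
  set b := volume.real (ball (0 : Eucl d) 1) with hb
  have hb0 : 0 < b := volume_real_unitBall_pos d
  set N := (4 * Real.pi * Real.exp 2) ^ (-(d / 2 : ℝ)) with hN
  have hN0 : 0 < N := by positivity
  have hNb : ENNReal.ofReal (N * b) ≠ 0 := by simpa using mul_pos hN0 hb0
  refine lt_of_le_of_lt ?_
    (ENNReal.div_lt_top (ENNReal.coe_ne_top (r := C)) hNb)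
  refine iSup_le fun x₀ => iSup_le fun r => iSup_le fun hr => ?_
  set E := 1 + r * (1 + ‖x₀‖) with hE
  set κ := N * (r ^ d)⁻¹ * Real.exp (-3 * E ^ 2) with hκ
  set Φ := growthFactor (harmonicPotential d) 2 (3 * K ^ 2) x₀ r with hΦ
  have hκ0 : 0 < κ := by positivity
  have hΦ0 : 0 < Φ := Real.exp_pos _
  have hΦE : Real.exp (3 * E ^ 2) ≤ Φ := by
    rw [hΦ, growthFactor, Real.rpow_two]
    refine Real.exp_le_exp.2 ?_
    have h1 := hK x₀ r hr
    have h2 : E ≤ K * (1 + r / criticalRadius (harmonicPotential d) x₀) := by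
      rw [div_le_iff₀ hK0] at h1
      linarith
    have h3 : 0 ≤ E := by positivity
    calc 3 * E ^ 2 ≤ 3 * (K * (1 + r / criticalRadius (harmonicPotential d) x₀)) ^ 2 := by gcongr
      _ = _ := by ring
  have hmain := mul_rpow_dual_le_of_heatMaximal_le hp hw hC (x₀ := x₀) (r := r)
    (t := min 1 (r ^ 2)) (κ := κ) (lt_min one_pos (by positivity)) (fun x hx y hy => by
      rw [heatKernel_harmonicPotential d (lt_min one_pos (by positivity))]
      exact le_mehler_of_mem_ball hr hx hy)
  set W := ∫⁻ y in ball x₀ r, ENNReal.ofReal (w y)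
  set S := ∫⁻ y in ball x₀ r, ENNReal.ofReal (w y) ^ (-(1 / (p - 1)))
  have hvol : volume (ball x₀ r) = ENNReal.ofReal (r ^ d * b) := by
    rw [← volume_real_ball x₀ hr, ofReal_measureReal measure_ball_lt_top.ne]
  have hv : volume (ball x₀ r) * ENNReal.ofReal Φ = ENNReal.ofReal (r ^ d * b * Φ) := by
    rw [hvol, ← ENNReal.ofReal_mul (by positivity)]
  rw [hv]
  set v := ENNReal.ofReal (r ^ d * b * Φ) with hv'
  have hv0 : v ≠ 0 := by
    have : 0 < r ^ d * b * Φ := by positivity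
    simpa [hv'] using this
  have hvt : v ≠ ⊤ := ENNReal.ofReal_ne_top
  have hexp : 1 / p + (p - 1) / p = 1 := by field_simp; ring
  have ha : 0 ≤ (p - 1) / p := div_nonneg (by linarith) hp0.le
  -- The two exponents add up to `1`, so the normaliser `|B| Φ` enters the product exactly once.
  have hvv : v ^ (1 / p) * v ^ ((p - 1) / p) = v := by
    rw [← ENNReal.rpow_add _ _ hv0 hvt, hexp, ENNReal.rpow_one]
  have hprod : (W / v) ^ (1 / p) * (S / v) ^ ((p - 1) / p)
      = W ^ (1 / p) * S ^ ((p - 1) / p) / v := by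
    rw [ENNReal.div_rpow_of_nonneg _ _ (by positivity), ENNReal.div_rpow_of_nonneg _ _ ha]
    have hinv : v⁻¹ = (v ^ (1 / p))⁻¹ * (v ^ ((p - 1) / p))⁻¹ := by
      rw [← ENNReal.mul_inv (Or.inr (ENNReal.rpow_ne_top_of_nonneg ha hvt))
        (Or.inl (ENNReal.rpow_ne_top_of_nonneg (by positivity) hvt)), hvv]
    rw [ENNReal.div_eq_inv_mul, ENNReal.div_eq_inv_mul, ENNReal.div_eq_inv_mul, hinv]
    ring
  rw [hprod, ENNReal.le_div_iff_mul_le (Or.inl hNb) (Or.inl ENNReal.ofReal_ne_top)]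
  -- The factor `r^d` of the volume cancels that of `κ`, and `Φ` outweighs the exponential loss.
  -- What remains depends only on `d`.
  have hle : ENNReal.ofReal (N * b) ≤ ENNReal.ofReal κ * v := by
    rw [hv', ← ENNReal.ofReal_mul hκ0.le]
    refine ENNReal.ofReal_le_ofReal ?_
    calc N * b = κ * (r ^ d * b * Real.exp (3 * E ^ 2)) := by
          rw [hκ, neg_mul, Real.exp_neg]
          field_simp
      _ ≤ κ * (r ^ d * b * Φ) := by gcongr
  calc W ^ (1 / p) * S ^ ((p - 1) / p) / v * ENNReal.ofReal (N * b)
      ≤ W ^ (1 / p) * S ^ ((p - 1) / p) / v * (ENNReal.ofReal κ * v) := by gcongr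
    _ = ENNReal.ofReal κ * W ^ (1 / p) * S ^ ((p - 1) / p) * (v⁻¹ * v) := by
        rw [div_eq_mul_inv]; ring
    _ ≤ C := by rw [ENNReal.inv_mul_cancel hv0 hvt, mul_one]; exact hmain
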